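/- Let $\Gamma$ be a bipartite distance-regular graph (finite, undirected, simple, connected) with vertex set $X$, path-length distance $\partial$, diameter $D\ge 4$, valency $k\ge 3$, and intersection numbers $p^h_{ij}=|\{z:\partial(x,z)=i,\ \partial(z,y)=j\}|$ (where $\partial(x,y)=h$), $c_i=p^i_{1,i-1}$, $c_0=0$, $b_i=p^i_{1,i+1}$, $b_D=0$, $k_i=p^0_{ii}$. Let $A_i\in \mathrm{Mat}_X(\mathbb C)$ be the $i$-th distance matrix, $A=A_1$ the adjacency matrix, $\theta_0>\theta_1>\cdots>\theta_D$ the distinct eigenvalues of $A$, and $E_j$ the primitive idempotent for $\theta_j$, i.e. the orthogonal projection of $V=\mathbb C^X$ onto the $\theta_j$-eigenspace of $A$. Fix $x\in X$. Let $E^*_i$ be the diagonal matrix whose $(y,y)$ entry is $1$ if $\partial(x,y)=i$ and $0$ otherwise, and let $T$ be the subalgebra of $\mathrm{Mat}_X(\mathbb C)$ generated by $A,E_0^*,\dots,E_D^*$. A $T$-module is a $T$-invariant subspace $W\subseteq V$; an irreducible $T$-module $W$ is thin if $\dim E_i^*W\le 1$ for $0\le i\le D$, and its endpoint is $\min\{i: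 0\le i\le D,\ E_i^*W\ne 0\}$. If $W$ is thin and irreducible with endpoint $2$, its local eigenvalue is the eigenvalue of $E_2^*A_2E_2^*$ on the one-dimensional space $E_2^*W$. Define polynomials $f_i\in\mathbb R[\lambda]$ by $f_{-1}=0$, $f_0=1$ and $\lambda f_i=b_{i-1}f_{i-1}+c_{i+1}f_{i+1}$ $(0\le i\le D-1)$, and put $p_i=f_i+f_{i-2}+f_{i-4}+\cdots$ (ending with $f_0$ or $f_1$) for $0\le i\le D$. Let $n\in\{1,\lfloor D/2\rfloor\}$ if $D$ is odd, and $n=1$ if $D$ is even. Put $\theta=\theta_n$ and $$\tilde\theta_n=-1-\frac{b_2b_3}{\theta_n^2-b_2},\qquad g_i=\sum_{\substack{0\le h\le i\\ i-h\ \mathrm{even}}}\frac{p_h(\theta)\,k_ib_ib_{i+1}}{p_i(\theta)\,k_hb_hb_{h+1}}\,p_h\qquad(0\le i\le D-2).$$ Let $W$ be a thin irreducible $T$-module with endpoint $2$ and local eigenvalue $\tilde\theta_n$, and let $v$ be a nonzero vector in $E_2^*W$. Then the vectors $E_jv$ $(1\le j\le D-1,\ j\ne n,\ j\ne D-n)$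 form a basis of $W$, the vectors $E^*_{i+2}A_iv$ $(0\le i\le D-4)$ form a basis of $W$, and the two bases are related by $$E^*_{i+2}A_iv=\sum_{\substack{1\le j\le D-1\\ j\ne n,\ j\ne D-n}}g_i(\theta_j)\,E_jv\qquad(0\le i\le D-4).$$ -/

import Mathlib

open Polynomial

namespace DRG

section Graph

variable {X : Type*} [Fintype X]

/-- `Γ` is distance-regular: it is connected, and the number of vertices `z` with
`∂(x,z) = i` and `∂(z,y) = j` depends only on `i`, `j` and `∂(x,y)`. -/
def IsDistanceRegular (Γ : SimpleGraph X) : Prop :=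
  Γ.Connected ∧ ∀ i j : ℕ, ∀ x y x' y' : X, Γ.dist x y = Γ.dist x' y' →
    (Finset.univ.filter fun z => Γ.dist x z = i ∧ Γ.dist z y = j).card =
      (Finset.univ.filter fun z => Γ.dist x' z = i ∧ Γ.dist z y' = j).card

/-- The intersection number `p^h_{ij}`: the number of `z` with `∂(x,z) = i` and `∂(z,y) = j`, where
`x, y` are at distance `h`. In a distance-regular graph all these pairs give the same
number; it is extracted here as a maximum over the pairs (which is `0` when there is no such pair). -/
noncomputable def intersectionNumber (Γ : SimpleGraph X) (h i j : ℕ) : ℕ :=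
  (Finset.univ.filter fun q : X × X => Γ.dist q.1 q.2 = h).sup fun q =>
    (Finset.univ.filter fun z => Γ.dist q.1 z = i ∧ Γ.dist z q.2 = j).card

/-- `c_i = p^i_{1,i-1}` for `i ≥ 1`, and `c_0 = 0`. -/
noncomputable def c (Γ : SimpleGraph X) : ℕ → ℝ
  | 0 => 0
  | i + 1 => intersectionNumber Γ (i + 1) 1 i

/-- `b_i = p^i_{1,i+1}`. (For `i` at least the diameter this is `0`.) -/
noncomputable def b (Γ : SimpleGraph X) (i : ℕ) : ℝ :=
  intersectionNumber Γ i 1 (i + 1)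

/-- The `i`-th valency `k_i = p^0_{ii}`. -/
noncomputable def kk (Γ : SimpleGraph X) (i : ℕ) : ℝ :=
  intersectionNumber Γ 0 i i

/-- The polynomials `f_i`: `f_0 = 1` and `λ f_i = b_{i-1} f_{i-1} + c_{i+1} f_{i+1}`, `f_{-1} = 0`. -/
noncomputable def f (Γ : SimpleGraph X) : ℕ → ℝ[X]
  | 0 => 1
  | 1 => C (c Γ 1)⁻¹ * Polynomial.X
  | i + 2 => C (c Γ (i + 2))⁻¹ * (Polynomial.X * f Γ (i + 1) - C (b Γ i) * f Γ i)

/-- `p_i = f_i + f_{i-2} + f_{i-4} + ⋯`, ending with `f_0` or `f_1`. -/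
noncomputable def p (Γ : SimpleGraph X) (i : ℕ) : ℝ[X] :=
  ∑ h ∈ (Finset.range (i + 1)).filter (fun h => Even (i - h)), f Γ h

/-- The polynomials `g_i` associated with the real number `θ`. -/
noncomputable def g (Γ : SimpleGraph X) (θ : ℝ) (i : ℕ) : ℝ[X] :=
  ∑ h ∈ (Finset.range (i + 1)).filter (fun h => Even (i - h)),
    C (((p Γ h).eval θ * kk Γ i * b Γ i * b Γ (i + 1)) /
       ((p Γ i).eval θ * kk Γ h * b Γ h * b Γ (h + 1))) * p Γ h

/-- `z̃ = -1 - b_2 b_3 / (z² - b_2)`, for a real number `z` with `z² ≠ b_2`. -/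
noncomputable def tilde (Γ : SimpleGraph X) (z : ℝ) : ℝ :=
  -1 - b Γ 2 * b Γ 3 / (z ^ 2 - b Γ 2)

end Graph

section Matrices

variable {X : Type*} [Fintype X] [DecidableEq X]

/-- The `i`-th distance matrix `A_i`. The adjacency matrix is `A_1`. -/
noncomputable def distMatrix (Γ : SimpleGraph X) (i : ℕ) : Matrix X X ℂ :=
  Matrix.of fun x y => if Γ.dist x y = i then 1 else 0

/-- The adjacency matrix acting on the Hermitian space `ℂ^X`. -/
noncomputable def adjOp (Γ : SimpleGraph X) :
    EuclideanSpace ℂ X →ₗ[ℂ] EuclideanSpace ℂ X :=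
  Matrix.toEuclideanLin (distMatrix Γ 1)

theorem finite_eigenvalues (Γ : SimpleGraph X) :
    {t : ℝ | Module.End.HasEigenvalue (adjOp Γ) (t : ℂ)}.Finite :=
  (Module.End.finite_hasEigenvalue (adjOp Γ)).preimage Complex.ofReal_injective.injOn

/-- `θ_i`: the entry number `i` (counted from `0`) in the list of the distinct eigenvalues of the
adjacency matrix, sorted in decreasing order. (The adjacency matrix is real symmetric, so all
its eigenvalues are real.) -/
noncomputable def eigenvalue (Γ : SimpleGraph X) (i : ℕ) : ℝ :=
  ((finite_eigenvalues Γ).toFinset.sort (fun s t => t ≤ s)).getD i 0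

/-- The primitive idempotent `E_i`: the matrix of the orthogonal projection of `ℂ^X` onto the
eigenspace of the adjacency matrix for `θ_i`. -/
noncomputable def primIdem (Γ : SimpleGraph X) (i : ℕ) : Matrix X X ℂ :=
  Matrix.toEuclideanLin.symm
    ((Module.End.eigenspace (adjOp Γ) (eigenvalue Γ i : ℂ)).starProjection :
      EuclideanSpace ℂ X →ₗ[ℂ] EuclideanSpace ℂ X)

/-- The dual idempotent `E*_i = E*_i(x)`. -/
noncomputable def dualIdem (Γ : SimpleGraph X) (x : X) (i : ℕ) : Matrix X X ℂ :=
  Matrix.diagonal fun y => if Γ.dist x y = i then 1 else 0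

/-- The Bose-Mesner algebra `M`. -/
def boseMesner (Γ : SimpleGraph X) : Subalgebra ℂ (Matrix X X ℂ) :=
  Algebra.adjoin ℂ {distMatrix Γ 1}

/-- The dual Bose-Mesner algebra `M* = M*(x)`. -/
def dualBoseMesner (Γ : SimpleGraph X) (x : X) : Subalgebra ℂ (Matrix X X ℂ) :=
  Algebra.adjoin ℂ (Set.range (dualIdem Γ x))

/-- The subconstituent algebra `T = T(x)`, generated by `M` and `M*`. -/
def subconstituentAlgebra (Γ : SimpleGraph X) (x : X) : Subalgebra ℂ (Matrix X X ℂ) :=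
  boseMesner Γ ⊔ dualBoseMesner Γ x

/-- A `T`-module: a subspace `W` of `ℂ^X` with `B W ⊆ W` for all `B ∈ T`. -/
def IsTModule (Γ : SimpleGraph X) (x : X) (W : Submodule ℂ (X → ℂ)) : Prop :=
  ∀ B ∈ subconstituentAlgebra Γ x, ∀ w ∈ W, B.mulVec w ∈ W

def IsIrreducibleTModule (Γ : SimpleGraph X) (x : X) (W : Submodule ℂ (X → ℂ)) : Prop :=
  IsTModule Γ x W ∧ W ≠ ⊥ ∧ ∀ W' : Submodule ℂ (X → ℂ), IsTModule Γ x W' → W' ≤ W →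
    W' = ⊥ ∨ W' = W

/-- The subspace `E*_i W`. -/
noncomputable def dualPart (Γ : SimpleGraph X) (x : X) (i : ℕ) (W : Submodule ℂ (X → ℂ)) :
    Submodule ℂ (X → ℂ) :=
  W.map (dualIdem Γ x i).mulVecLin

/-- `W` is thin: `dim E*_i W ≤ 1` for `0 ≤ i ≤ D`. -/
def IsThin (Γ : SimpleGraph X) (x : X) (W : Submodule ℂ (X → ℂ)) : Prop :=
  ∀ i ≤ Γ.diam, Module.finrank ℂ (dualPart Γ x i W) ≤ 1

/-- The endpoint `min {i | 0 ≤ i ≤ D, E*_i W ≠ 0}` of `W`. -/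
noncomputable def endpoint (Γ : SimpleGraph X) (x : X) (W : Submodule ℂ (X → ℂ)) : ℕ :=
  sInf {i | i ≤ Γ.diam ∧ dualPart Γ x i W ≠ ⊥}

/-- `η` is the local eigenvalue of `W` (a thin irreducible `T`-module with endpoint `2`): the
nonzero space `E*_2 W` consists of eigenvectors of `E*_2 A_2 E*_2` with eigenvalue `η`. -/
def HasLocalEigenvalue (Γ : SimpleGraph X) (x : X) (W : Submodule ℂ (X → ℂ)) (η : ℝ) : Prop :=
  dualPart Γ x 2 W ≠ ⊥ ∧ ∀ w ∈ dualPart Γ x 2 W,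
    (dualIdem Γ x 2 * distMatrix Γ 2 * dualIdem Γ x 2).mulVec w = (η : ℂ) • w

/-- The index set `{j | 1 ≤ j ≤ D - 1, j ≠ n, j ≠ D - n}`. -/
def indexSet (D n : ℕ) : Finset ℕ :=
  (Finset.Icc 1 (D - 1)).filter fun j => j ≠ n ∧ j ≠ D - n

end Matrices

end DRG

/-! Write `k = b_0`, `up_i = E*_{i+2} A_i v` and `lo_i = E*_i A_{i+2} v`. Everything is expressed
through these two families.

Since `E*_0 W = E*_1 W = 0`, the entries of `v` sum to zero, so on each sphere around `x` the middle
part of `A_i v` is determined by the two outer ones. Summing gives `p_i(A) v = up_i - lo_i`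
(`aeval_p`). Projecting the three-term recurrence of the `p_i` (`X_mul_p`) onto spheres shows how
`A` acts on the `up_i` and `lo_i`. Together with thinness and irreducibility, it follows that the
nonzero `up_i` are an initial segment `i < N` spanning `W` (`exists_span_up`), and that `v`
generates `W` under `A` alone (`le_of_adj_invariant`).

The entries of `E_j` depend only on distance and satisfy a three-term recurrence, so `‖E_j v‖²` is a
positive multiple of `(k² - θ_j²)(b_2 b_3 + (1 + η)(θ_j² - b_2))`, where `η` is the local
eigenvalue. For `η` equal to `tilde` of `θ_n` this vanishes exactly when `θ_j² = k²` or `θ_j² =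
θ_n²`, that is, for `j` in `{0, D, n, D - n}`. The `D - 3` remaining `E_j v` are eigenvectors for
distinct eigenvalues with `A`-invariant span containing `v`, hence a basis of `W`; comparing
dimensions, `N = D - 3`. That `θ_n² ≠ b_2`, so that `tilde` makes sense, follows from a weighted sum
over the spectrum (`eigenvalue_sq_sub_not_signed`).

For the transition formula, thinness gives `lo_{i+2} = ρ_i up_i`, hence `up_{i+2} = p_{i+2}(A) v +
ρ_i up_i`. Lowering `lo` in two ways yields a recurrence for the `ρ_i`, solved in closed form by
`ratio_recurrence`; the result is the coefficient in the recursion of the `g_i` (`g_add_two`). So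
`up_i = g_i(A) v`, and `v = ∑ E_j v` finishes the proof. -/

namespace DRG

/-! ### Distances and intersection numbers of a bipartite distance-regular graph. -/

section Graph

variable {X : Type*} {Γ : SimpleGraph X}

theorem exists_adj_dist (hc : Γ.Connected) {u z : X} {i : ℕ} (h : Γ.dist u z = i + 1) :
    ∃ w, Γ.Adj u w ∧ Γ.dist w z = i := by
  obtain ⟨p, hp⟩ := hc.exists_walk_length_eq_dist u z
  cases p with
  | nil => simp at h
  | @cons _ w _ ha q =>
    refine ⟨w, ha, ?_⟩
    have h1 := SimpleGraph.dist_le q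
    have h2 := hc.dist_triangle (u := u) (v := w) (w := z)
    have h3 := SimpleGraph.dist_eq_one_iff_adj.2 ha
    simp only [SimpleGraph.Walk.length_cons] at hp
    omega

theorem even_dist_add (hc : Γ.Connected) (hb : Γ.IsBipartite) (u w z : X) :
    Even (Γ.dist u w + Γ.dist w z + Γ.dist u z) := by
  obtain ⟨C⟩ := hb
  have key : ∀ a b : X, Even (Γ.dist a b) ↔ (C a = C b) := by
    intro a b
    let C' : Γ.Coloring Bool := SimpleGraph.Coloring.mk (fun v => decide (C v = 0)) (by
      intro v w hvw
      have := C.valid hvw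
      generalize C v = p at *
      generalize C w = q at *
      fin_cases p <;> fin_cases q <;> simp_all)
    obtain ⟨p, hp⟩ := hc.exists_walk_length_eq_dist a b
    rw [← hp, C'.even_length_iff_congr p]
    change (decide (C a = 0) = true ↔ decide (C b = 0) = true) ↔ _
    generalize C a = p
    generalize C b = q
    fin_cases p <;> fin_cases q <;> simp
  have h1 := key u w
  have h2 := key w z
  have h3 := key u z
  rw [Nat.even_add, Nat.even_add, h1, h2, h3]
  generalize C u = p
  generalize C w = q
  generalize C z = r
  fin_cases p <;> fin_cases q <;> fin_cases r <;> simp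

theorem dist_of_adj (hc : Γ.Connected) (hb : Γ.IsBipartite) {u w : X} (z : X)
    (h : Γ.dist u w = 1) :
    Γ.dist w z = Γ.dist u z + 1 ∨ Γ.dist w z + 1 = Γ.dist u z := by
  have h1 := hc.dist_triangle (u := u) (v := w) (w := z)
  have h2 := hc.dist_triangle (u := w) (v := u) (w := z)
  have h3 := even_dist_add hc hb u w z
  rw [SimpleGraph.dist_comm (u := w) (v := u)] at h2
  rcases h3 with ⟨r, hr⟩
  omega

theorem exists_dist_eq (hc : Γ.Connected) {i : ℕ} (hi : i ≤ Γ.diam) :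
    ∃ u z : X, Γ.dist u z = i := by
  have : Nonempty X := hc.nonempty
  obtain ⟨u, z, h⟩ := Γ.exists_dist_eq_diam
  suffices ∀ m, m ≤ Γ.diam → ∃ u, Γ.dist u z = Γ.diam - m by
    obtain ⟨u, hu⟩ := this (Γ.diam - i) (by omega)
    exact ⟨u, z, by omega⟩
  intro m
  induction m with
  | zero => exact fun _ => ⟨u, by simpa using h⟩
  | succ m ih =>
    intro hm
    obtain ⟨u, hu⟩ := ih (by omega)
    obtain ⟨w, -, hw⟩ := exists_adj_dist hc (u := u) (z := z) (i := Γ.diam - (m + 1)) (by omega)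
    exact ⟨w, hw⟩

variable [Fintype X]

theorem IsDistanceRegular.card_eq (hΓ : IsDistanceRegular Γ) (i j : ℕ) (x y : X) :
    (Finset.univ.filter fun z => Γ.dist x z = i ∧ Γ.dist z y = j).card =
      intersectionNumber Γ (Γ.dist x y) i j := by
  unfold intersectionNumber
  apply le_antisymm
  · exact Finset.le_sup (f := fun q : X × X =>
      (Finset.univ.filter fun z => Γ.dist q.1 z = i ∧ Γ.dist z q.2 = j).card) (b := (x, y)) (by simp)
  · apply Finset.sup_le
    rintro ⟨u, w⟩ h
    simp only [Finset.mem_filter, Finset.mem_univ, true_and] at h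
    exact (hΓ.2 i j u w x y h).le

theorem dist_le_diam (hc : Γ.Connected) (x y : X) : Γ.dist x y ≤ Γ.diam := by
  have : Nonempty X := ⟨x⟩
  exact SimpleGraph.dist_le_diam (SimpleGraph.connected_iff_ediam_ne_top.1 hc)

theorem c_zero : c Γ 0 = 0 := rfl

/-- The sum over the neighbours of `y` of a function of the distance to `z`. -/
theorem sum_neighbors (hΓ : IsDistanceRegular Γ) (hb : Γ.IsBipartite) {R : Type*} [CommRing R]
    [Algebra ℝ R] (F : ℕ → R) (y z : X) :
    ∑ w, (if Γ.dist y w = 1 then 1 else 0) * F (Γ.dist w z) =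
      algebraMap ℝ R (c Γ (Γ.dist y z)) * F (Γ.dist y z - 1) +
        algebraMap ℝ R (b Γ (Γ.dist y z)) * F (Γ.dist y z + 1) := by
  have h2 : algebraMap ℝ R (b Γ (Γ.dist y z)) * F (Γ.dist y z + 1) =
      ∑ w, (if Γ.dist y w = 1 ∧ Γ.dist w z = Γ.dist y z + 1 then F (Γ.dist y z + 1) else 0) := by
    rw [← Finset.sum_filter, Finset.sum_const, hΓ.card_eq, b, nsmul_eq_mul, map_natCast]
  have h1 : algebraMap ℝ R (c Γ (Γ.dist y z)) * F (Γ.dist y z - 1) =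
      ∑ w, (if Γ.dist y w = 1 ∧ Γ.dist w z + 1 = Γ.dist y z then F (Γ.dist y z - 1) else 0) := by
    -- At distance `0` the truncated argument `0 - 1` is harmless because its coefficient is `c_0 =
    -- 0`.
    rcases Nat.eq_zero_or_pos (Γ.dist y z) with h0 | h0
    · simp [h0, c_zero]
    · obtain ⟨m, hm⟩ := Nat.exists_eq_add_of_lt h0
      rw [zero_add] at hm
      have := hΓ.card_eq 1 m y z
      simp only [hm, Nat.add_right_cancel_iff]
      rw [hm] at this
      rw [← Finset.sum_filter, Finset.sum_const, this, c, nsmul_eq_mul, map_natCast]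
  rw [h1, h2, ← Finset.sum_add_distrib]
  refine Finset.sum_congr rfl fun w _ => ?_
  by_cases hw : Γ.dist y w = 1
  · rcases dist_of_adj hΓ.1 hb z hw with h | h
    · have : ¬ Γ.dist w z + 1 = Γ.dist y z := by omega
      simp [hw, h]
      omega
    · have : ¬ Γ.dist w z = Γ.dist y z + 1 := by omega
      rw [if_pos hw, if_pos (⟨hw, h⟩ : _ ∧ _ + 1 = _),
        if_neg fun h' => this h'.2, ← h, Nat.add_sub_cancel]
      ring
  · simp [hw]

theorem b_add_c (hΓ : IsDistanceRegular Γ) (hb : Γ.IsBipartite) {i : ℕ} (hi : i ≤ Γ.diam) :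
    b Γ i + c Γ i = b Γ 0 := by
  obtain ⟨y, z, h⟩ := exists_dist_eq hΓ.1 hi
  have h1 := sum_neighbors hΓ hb (R := ℝ) (fun _ => 1) y z
  have h2 := sum_neighbors hΓ hb (R := ℝ) (fun _ => 1) y y
  simp [h, c_zero] at h1 h2
  rw [h1] at h2
  linarith

theorem c_pos (hΓ : IsDistanceRegular Γ) {i : ℕ} (h0 : 1 ≤ i) (hi : i ≤ Γ.diam) :
    0 < c Γ i := by
  obtain ⟨y, z, h⟩ := exists_dist_eq hΓ.1 hi
  obtain ⟨m, rfl⟩ := Nat.exists_eq_add_of_le' h0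
  obtain ⟨w, hw, hwz⟩ := exists_adj_dist hΓ.1 h
  have := hΓ.card_eq 1 m y z
  rw [h] at this
  rw [c, ← this]
  exact_mod_cast Finset.card_pos.2 ⟨w, by simp [hw, hwz]⟩

theorem b_pos (hΓ : IsDistanceRegular Γ) {i : ℕ} (hi : i < Γ.diam) : 0 < b Γ i := by
  obtain ⟨y, z, h⟩ := exists_dist_eq hΓ.1 (Nat.succ_le_of_lt hi)
  obtain ⟨w, hw, hwz⟩ := exists_adj_dist hΓ.1 h
  have := hΓ.card_eq 1 (i + 1) w z
  rw [hwz] at this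
  rw [b, ← this]
  exact_mod_cast Finset.card_pos.2 ⟨y, by simp [hw.symm, h]⟩

theorem c_one (hΓ : IsDistanceRegular Γ) (h : 1 ≤ Γ.diam) : c Γ 1 = 1 := by
  obtain ⟨y, z, h⟩ := exists_dist_eq hΓ.1 h
  have := hΓ.card_eq 1 0 y z
  rw [h] at this
  rw [c, ← this]
  have : (Finset.univ.filter fun w => Γ.dist y w = 1 ∧ Γ.dist w z = 0) = {z} := by
    ext w
    simp only [Finset.mem_filter, Finset.mem_univ, true_and, Finset.mem_singleton,
      hΓ.1.dist_eq_zero_iff]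
    constructor
    · exact fun h => h.2
    · rintro rfl; exact ⟨h, rfl⟩
  simp [this]

theorem kk_zero (hΓ : IsDistanceRegular Γ) : kk Γ 0 = 1 := by
  obtain ⟨y⟩ := hΓ.1.nonempty
  have := hΓ.card_eq 0 0 y y
  rw [SimpleGraph.dist_self] at this
  rw [kk, ← this]
  have : (Finset.univ.filter fun w => Γ.dist y w = 0 ∧ Γ.dist w y = 0) = {y} := by
    ext w
    simp only [Finset.mem_filter, Finset.mem_univ, true_and, Finset.mem_singleton,
      hΓ.1.dist_eq_zero_iff]
    constructor
    · exact fun h => h.2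
    · rintro rfl; simp
  simp [this]

theorem card_dist_eq (hΓ : IsDistanceRegular Γ) (i : ℕ) (y : X) :
    ((Finset.univ.filter fun z => Γ.dist z y = i).card : ℝ) = kk Γ i := by
  have := hΓ.card_eq i i y y
  rw [SimpleGraph.dist_self] at this
  rw [kk, ← this]
  congr 2
  ext z
  simp [SimpleGraph.dist_comm (u := y) (v := z)]

/-- Double counting of the edges between the sets of vertices at distance `i` and `i + 1`. -/
theorem kk_mul_b (hΓ : IsDistanceRegular Γ) (i : ℕ) :
    kk Γ i * b Γ i = kk Γ (i + 1) * c Γ (i + 1) := by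
  obtain ⟨z⟩ := hΓ.1.nonempty
  have h := Finset.sum_card_bipartiteAbove_eq_sum_card_bipartiteBelow
    (s := Finset.univ.filter fun w => Γ.dist w z = i)
    (t := Finset.univ.filter fun w => Γ.dist w z = i + 1) (fun u w => Γ.dist u w = 1)
  simp only [Finset.bipartiteAbove, Finset.bipartiteBelow, Finset.filter_filter] at h
  have h1 : ∀ u ∈ Finset.univ.filter (fun w => Γ.dist w z = i),
      (Finset.univ.filter fun w => Γ.dist w z = i + 1 ∧ Γ.dist u w = 1).card =
        intersectionNumber Γ i 1 (i + 1) := by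
    intro u hu
    rw [Finset.mem_filter] at hu
    rw [← hu.2, ← hΓ.card_eq]
    simp_rw [and_comm]
  have h2 : ∀ u ∈ Finset.univ.filter (fun w => Γ.dist w z = i + 1),
      (Finset.univ.filter fun w => Γ.dist w z = i ∧ Γ.dist w u = 1).card =
        intersectionNumber Γ (i + 1) 1 i := by
    intro u hu
    rw [Finset.mem_filter] at hu
    rw [← hu.2, ← hΓ.card_eq]
    refine congrArg Finset.card (Finset.filter_congr fun w _ => ?_)
    rw [and_comm, SimpleGraph.dist_comm]
  rw [Finset.sum_congr rfl h1, Finset.sum_congr rfl h2, Finset.sum_const, Finset.sum_const,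
    smul_eq_mul, smul_eq_mul] at h
  rw [← card_dist_eq hΓ i z, ← card_dist_eq hΓ (i + 1) z, b, c]
  exact_mod_cast h

theorem kk_pos (hΓ : IsDistanceRegular Γ) {i : ℕ} (hi : i ≤ Γ.diam) : 0 < kk Γ i := by
  obtain ⟨y, z, h⟩ := exists_dist_eq hΓ.1 hi
  rw [← card_dist_eq hΓ i z]
  exact_mod_cast Finset.card_pos.2 ⟨y, by simp [h]⟩

end Graph

/-! ### Recurrences for the polynomials `f_i`, `p_i` and `g_i`. -/

section Polynomials

variable {X : Type*} [Fintype X] {Γ : SimpleGraph X}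

theorem sum_filter_even_sub {M : Type*} [AddCommMonoid M] (F : ℕ → M) (i : ℕ) :
    ∑ h ∈ (Finset.range (i + 2 + 1)).filter (fun h => Even (i + 2 - h)), F h =
      F (i + 2) + ∑ h ∈ (Finset.range (i + 1)).filter (fun h => Even (i - h)), F h := by
  rw [Finset.range_add_one, Finset.filter_insert, if_pos (by simp), Finset.sum_insert (by simp),
    show i + 2 = i + 1 + 1 from rfl, Finset.range_add_one, Finset.filter_insert,
    if_neg (by simp [show i + 1 + 1 - (i + 1) = 1 by omega])]
  congr 2
  refine Finset.filter_congr fun h hh => ?_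
  rw [Finset.mem_range] at hh
  rw [show i + 1 + 1 - h = i - h + 2 by omega, Nat.even_add]
  simp

theorem filter_even_one_sub : (Finset.range (1 + 1)).filter (fun h => Even (1 - h)) = {1} := by
  decide

theorem p_zero : p Γ 0 = 1 := by
  simp [p, f]

theorem p_one : p Γ 1 = f Γ 1 := by
  rw [p, filter_even_one_sub, Finset.sum_singleton]

theorem p_add_two (i : ℕ) : p Γ (i + 2) = f Γ (i + 2) + p Γ i :=
  sum_filter_even_sub _ _

theorem f_one (hΓ : IsDistanceRegular Γ) (hD : 1 ≤ Γ.diam) : f Γ 1 = Polynomial.X := by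
  simp [f, c_one hΓ hD]

theorem X_mul_f (hΓ : IsDistanceRegular Γ) {i : ℕ} (hi : i + 2 ≤ Γ.diam) :
    Polynomial.X * f Γ (i + 1) = C (b Γ i) * f Γ i + C (c Γ (i + 2)) * f Γ (i + 2) := by
  have := (c_pos hΓ (by omega) hi).ne'
  rw [f, ← mul_assoc, ← C_mul, mul_inv_cancel₀ this]
  simp

/-- Multiplying `p_{i+1}` by `λ` termwise, each `f_h` with `h ≤ i` of the right parity collects `b_h
+ c_h = k`, so the product is `c_{i+2} f_{i+2} + k p_i`. Now substitute `f_{i+2} = p_{i+2} - p_i`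
and `k - c_{i+2} = b_{i+2}`. -/
theorem X_mul_p (hΓ : IsDistanceRegular Γ) (hb : Γ.IsBipartite) {i : ℕ} (hi : i + 2 ≤ Γ.diam) :
    Polynomial.X * p Γ (i + 1) = C (c Γ (i + 2)) * p Γ (i + 2) + C (b Γ (i + 2)) * p Γ i := by
  induction i using Nat.twoStepInduction with
  | zero =>
    have h := b_add_c hΓ hb hi
    rw [p_one, X_mul_f hΓ hi, p_add_two, p_zero, ← h, C_add, f]
    ring
  | one =>
    have h := b_add_c hΓ hb hi
    have h1 := b_add_c hΓ hb (i := 1) (by omega)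
    rw [p_add_two 0, mul_add, X_mul_f hΓ hi, p_add_two 1, p_zero, p_one, mul_one,
      ← f_one hΓ (by omega)]
    have h2 : C (b Γ 1) = C (c Γ 3) + C (b Γ 3) - 1 := by
      rw [← C_1, ← C_add, ← C_sub]
      rw [c_one hΓ (by omega)] at h1
      congr 1
      linarith
    rw [h2]
    ring
  | more i ih _ =>
    have h := b_add_c hΓ hb hi
    have h1 := b_add_c hΓ hb (i := i + 2) (by omega)
    have h2 : C (b Γ (i + 2)) = C (c Γ (i + 4)) + C (b Γ (i + 4)) - C (c Γ (i + 2)) := by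
      rw [← C_add, ← C_sub]
      congr 1
      linarith
    rw [show i + 2 + 1 = i + 1 + 2 from rfl, p_add_two (i + 1), mul_add, ih (by omega),
      show i + 1 + 2 = i + 2 + 1 from rfl, X_mul_f hΓ hi, p_add_two (i + 2), p_add_two i, h2]
    ring

theorem g_zero (hΓ : IsDistanceRegular Γ) (hD : 2 ≤ Γ.diam) (θ : ℝ) : g Γ θ 0 = 1 := by
  have h0 := (b_pos hΓ (i := 0) (by omega)).ne'
  have h1 := (b_pos hΓ (i := 1) (by omega)).ne'
  simp [g, p_zero, kk_zero hΓ, h0, h1]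

theorem g_one (hΓ : IsDistanceRegular Γ) (hD : 3 ≤ Γ.diam) {θ : ℝ} (hθ : θ ≠ 0) :
    g Γ θ 1 = p Γ 1 := by
  have h0 := (b_pos hΓ (i := 1) (by omega)).ne'
  have h1 := (b_pos hΓ (i := 2) (by omega)).ne'
  have h2 := (kk_pos hΓ (i := 1) (by omega)).ne'
  rw [g, filter_even_one_sub, Finset.sum_singleton, div_self, C_1, one_mul]
  simp [p_one, f_one hΓ (by omega), h0, h1, h2, hθ]

/-- Passing from `i` to `i + 2` rescales all coefficients with `h ≤ i` by one common factor,
simplified by `k_{i+2} / k_i = b_i b_{i+1} / (c_{i+1} c_{i+2})`. The factor has to match the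
thinness ratio `ρ_i` in `aeval_g`. -/
theorem g_add_two (hΓ : IsDistanceRegular Γ) {θ : ℝ} {i : ℕ} (hi : i + 4 ≤ Γ.diam)
    (h1 : (p Γ i).eval θ ≠ 0) (h2 : (p Γ (i + 2)).eval θ ≠ 0) :
    g Γ θ (i + 2) = p Γ (i + 2) +
      C ((p Γ i).eval θ * b Γ (i + 2) * b Γ (i + 3) /
        ((p Γ (i + 2)).eval θ * c Γ (i + 1) * c Γ (i + 2))) * g Γ θ i := by
  have hb0 := (b_pos hΓ (i := i) (by omega)).ne'
  have hb1 := (b_pos hΓ (i := i + 1) (by omega)).ne'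
  have hb2 := (b_pos hΓ (i := i + 2) (by omega)).ne'
  have hb3 := (b_pos hΓ (i := i + 3) (by omega)).ne'
  have hc1 := (c_pos hΓ (i := i + 1) (by omega) (by omega)).ne'
  have hc2 := (c_pos hΓ (i := i + 2) (by omega) (by omega)).ne'
  have hk := (kk_pos hΓ (i := i) (by omega)).ne'
  have hk2 := (kk_pos hΓ (i := i + 2) (by omega)).ne'
  have e1 := kk_mul_b hΓ i
  have e2 := kk_mul_b hΓ (i + 1)
  have e3 : kk Γ (i + 2) = kk Γ i * b Γ i * b Γ (i + 1) / (c Γ (i + 1) * c Γ (i + 2)) := by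
    rw [eq_div_iff (by positivity), e1, mul_comm (kk Γ (i + 1)), mul_assoc, e2]
    ring
  rw [g, sum_filter_even_sub, div_self (by positivity), C_1, one_mul, g, Finset.mul_sum]
  congr 1
  refine Finset.sum_congr rfl fun h hh => ?_
  have hh' : h ≤ i := by
    have := (Finset.mem_filter.1 hh).1
    rw [Finset.mem_range] at this
    omega
  have hbh := (b_pos hΓ (i := h) (by omega)).ne'
  have hbh1 := (b_pos hΓ (i := h + 1) (by omega)).ne'
  have hkh := (kk_pos hΓ (i := h) (by omega)).ne'
  rw [← mul_assoc, ← C_mul, e3]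
  congr 2
  field_simp

theorem degree_f (hΓ : IsDistanceRegular Γ) {i : ℕ} (hi : i ≤ Γ.diam) : (f Γ i).degree = i := by
  induction i using Nat.twoStepInduction with
  | zero => simp [f]
  | one => rw [f_one hΓ hi]; simp
  | more i ih1 ih2 =>
    have hc := (c_pos hΓ (by omega) hi).ne'
    have hb := (b_pos hΓ (i := i) (by omega)).ne'
    have e1 : (Polynomial.X * f Γ (i + 1)).degree = ((i + 2 : ℕ) : WithBot ℕ) := by
      rw [degree_mul, degree_X, ih2 (by omega)]
      norm_cast
      omega
    have e2 : (C (b Γ i) * f Γ i).degree = (i : WithBot ℕ) := by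
      rw [degree_C_mul hb, ih1 (by omega)]
    rw [f, degree_C_mul (inv_ne_zero hc), degree_sub_eq_left_of_degree_lt, e1]
    rw [e1, e2]
    norm_cast
    omega

end Polynomials

/-! ### Distance matrices as polynomials in the adjacency matrix. -/

section Matrices

variable {X : Type*} {Γ : SimpleGraph X}

theorem distMatrix_one_eq_adjMatrix [DecidableRel Γ.Adj] :
    distMatrix Γ 1 = Γ.adjMatrix ℂ := by
  ext y z
  simp [distMatrix, SimpleGraph.adjMatrix_apply]

variable [Fintype X]

theorem adj_mul_of (hΓ : IsDistanceRegular Γ) (hb : Γ.IsBipartite) (F : ℕ → ℂ) (y z : X) :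
    (distMatrix Γ 1 * Matrix.of fun y z => F (Γ.dist y z)) y z =
      c Γ (Γ.dist y z) * F (Γ.dist y z - 1) + b Γ (Γ.dist y z) * F (Γ.dist y z + 1) := by
  rw [← Complex.coe_algebraMap, ← sum_neighbors hΓ hb, Matrix.mul_apply]
  rfl

theorem distMatrix_of_diam_lt (hΓ : IsDistanceRegular Γ) {i : ℕ} (hi : Γ.diam < i) :
    distMatrix Γ i = 0 := by
  ext y z
  have := dist_le_diam hΓ.1 y z
  simp [distMatrix]
  omega

theorem adj_mul_distMatrix (hΓ : IsDistanceRegular Γ) (hb : Γ.IsBipartite) (i : ℕ) :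
    distMatrix Γ 1 * distMatrix Γ (i + 1) =
      b Γ i • distMatrix Γ i + c Γ (i + 2) • distMatrix Γ (i + 2) := by
  ext y z
  have := adj_mul_of hΓ hb (fun j => if j = i + 1 then 1 else 0) y z
  change (distMatrix Γ 1 * distMatrix Γ (i + 1)) y z = _ at this
  rw [this]
  simp only [distMatrix, Matrix.add_apply, Matrix.smul_apply, Matrix.of_apply]
  rcases Nat.eq_zero_or_pos (Γ.dist y z) with h0 | h0
  · by_cases hi : i = 0 <;> simp [h0, c_zero, hi, eq_comm]
  · by_cases h1 : Γ.dist y z = i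
    · have : ¬ i - 1 = i + 1 := by omega
      simp [h1, this]
    · by_cases h2 : Γ.dist y z = i + 2
      · simp [h2]
      · have : ¬ Γ.dist y z - 1 = i + 1 := by omega
        simp [h1, h2, this]

variable [DecidableEq X]

theorem distMatrix_zero (hΓ : IsDistanceRegular Γ) : distMatrix Γ 0 = 1 := by
  ext y z
  simp [distMatrix, Matrix.one_apply, hΓ.1.dist_eq_zero_iff]

theorem aeval_f (hΓ : IsDistanceRegular Γ) (hb : Γ.IsBipartite) {i : ℕ} (hi : i ≤ Γ.diam) :
    aeval (distMatrix Γ 1) (f Γ i) = distMatrix Γ i := by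
  induction i using Nat.twoStepInduction with
  | zero => simp [f, distMatrix_zero hΓ]
  | one => rw [f_one hΓ hi]; simp
  | more i ih1 ih2 =>
    have hc := (c_pos hΓ (by omega) hi).ne'
    rw [f, map_mul, map_sub, map_mul, map_mul, aeval_X, aeval_C, aeval_C, ih1 (by omega),
      ih2 (by omega), adj_mul_distMatrix hΓ hb, ← Algebra.smul_def, ← Algebra.smul_def,
      add_sub_cancel_left, smul_smul, inv_mul_cancel₀ hc, one_smul]

/-- A polynomial of degree `D + 1` that annihilates the adjacency matrix. -/
theorem exists_annihilator (hΓ : IsDistanceRegular Γ) (hb : Γ.IsBipartite) (hD : 1 ≤ Γ.diam) :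
    ∃ q : ℝ[X], q.degree = ((Γ.diam + 1 : ℕ) : WithBot ℕ) ∧ aeval (distMatrix Γ 1) q = 0 := by
  obtain ⟨e, he⟩ := Nat.exists_eq_add_of_le' hD
  -- Here `D = e + 1`; the witness is what the recurrence would call `c_{D+1} f_{D+1}`, and it
  -- annihilates because `A_{D+1} = 0`.
  refine ⟨Polynomial.X * f Γ (e + 1) - C (b Γ e) * f Γ e, ?_, ?_⟩
  · have e1 : (Polynomial.X * f Γ (e + 1)).degree = ((e + 2 : ℕ) : WithBot ℕ) := by
      rw [degree_mul, degree_X, degree_f hΓ (by omega)]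
      norm_cast
      omega
    have e2 : (C (b Γ e) * f Γ e).degree = (e : WithBot ℕ) := by
      rw [degree_C_mul (b_pos hΓ (by omega)).ne', degree_f hΓ (by omega)]
    rw [degree_sub_eq_left_of_degree_lt, e1, he]
    rw [e1, e2]
    norm_cast
    omega
  · rw [map_sub, map_mul, map_mul, aeval_X, aeval_C, aeval_f hΓ hb (by omega),
      aeval_f hΓ hb (by omega), adj_mul_distMatrix hΓ hb, ← Algebra.smul_def,
      distMatrix_of_diam_lt hΓ (i := e + 2) (by omega)]
    simp

/-- Every polynomial in the adjacency matrix has entries depending only on the distance. -/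
theorem exists_aeval_eq (hΓ : IsDistanceRegular Γ) (hb : Γ.IsBipartite) (q : ℝ[X]) :
    ∃ F : ℕ → ℂ, aeval (distMatrix Γ 1) q = Matrix.of fun y z => F (Γ.dist y z) := by
  induction q using Polynomial.induction_on' with
  | add q r hq hr =>
    obtain ⟨F, hF⟩ := hq
    obtain ⟨G, hG⟩ := hr
    refine ⟨F + G, ?_⟩
    rw [map_add, hF, hG]
    rfl
  | monomial n a =>
    induction n with
    | zero =>
      refine ⟨fun j => if j = 0 then a else 0, ?_⟩
      rw [monomial_zero_left, aeval_C, Algebra.algebraMap_eq_smul_one, ← distMatrix_zero hΓ]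
      ext y z
      simp [distMatrix]
    | succ n ih =>
      obtain ⟨F, hF⟩ := ih
      refine ⟨fun j => c Γ j * F (j - 1) + b Γ j * F (j + 1), ?_⟩
      rw [← X_mul_monomial, map_mul, aeval_X, hF]
      ext y z
      exact adj_mul_of hΓ hb F y z

/-- No nonzero polynomial of degree at most `D` annihilates the adjacency matrix. -/
theorem diam_lt_degree (hΓ : IsDistanceRegular Γ) {q : ℝ[X]} (hq : q ≠ 0)
    (h0 : aeval (distMatrix Γ 1) q = 0) : Γ.diam < q.natDegree := by
  by_contra! hle
  classical
  -- At vertices whose distance is the degree of `q`, only the leading power of `A` has a nonzero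
  -- entry: shorter walks do not connect them.
  obtain ⟨y, z, hyz⟩ := exists_dist_eq hΓ.1 hle
  have h1 := congrFun (congrFun h0 y) z
  rw [aeval_eq_sum_range, Matrix.sum_apply, Finset.sum_range_succ, Finset.sum_eq_zero, zero_add,
    Matrix.smul_apply, distMatrix_one_eq_adjMatrix,
    SimpleGraph.adjMatrix_pow_apply_eq_card_walk] at h1
  · obtain ⟨w, hw⟩ := hΓ.1.exists_walk_length_eq_dist y z
    have hpos : 0 < Fintype.card {w : Γ.Walk y z | w.length = q.natDegree} :=
      Fintype.card_pos_iff.2 ⟨⟨w, hw.trans hyz⟩⟩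
    exact absurd h1 (smul_ne_zero (leadingCoeff_ne_zero.2 hq) (Nat.cast_ne_zero.2 hpos.ne'))
  · intro i hi
    rw [Finset.mem_range] at hi
    rw [Matrix.smul_apply, distMatrix_one_eq_adjMatrix,
      SimpleGraph.adjMatrix_pow_apply_eq_card_walk]
    have : IsEmpty {w : Γ.Walk y z | w.length = i} := by
      constructor
      rintro ⟨w, hw⟩
      have h2 := SimpleGraph.dist_le w
      have h3 : w.length = i := hw
      omega
    rw [Fintype.card_eq_zero]
    simp

end Matrices

/-! ### Spectral decomposition of the adjacency matrix and the ordering of its eigenvalues. -/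

section Spectrum

variable {X : Type*} [Fintype X] {Γ : SimpleGraph X}

theorem sum_adj_row (hΓ : IsDistanceRegular Γ) (hb : Γ.IsBipartite) (y : X) :
    ∑ z, (if Γ.dist y z = 1 then (1 : ℝ) else 0) = b Γ 0 := by
  have := sum_neighbors hΓ hb (R := ℝ) (fun _ => 1) y y
  simpa [c_zero] using this

variable [DecidableEq X]

/-- The finite set of eigenvalues of the adjacency matrix. -/
noncomputable def spec (Γ : SimpleGraph X) : Finset ℝ :=
  (finite_eigenvalues Γ).toFinset

/-- The matrix of the orthogonal projection onto the eigenspace of the adjacency matrix for `t`. -/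
noncomputable def eigenProj (Γ : SimpleGraph X) (t : ℝ) : Matrix X X ℂ :=
  Matrix.toEuclideanLin.symm
    ((Module.End.eigenspace (adjOp Γ) (t : ℂ)).starProjection :
      EuclideanSpace ℂ X →ₗ[ℂ] EuclideanSpace ℂ X)

theorem primIdem_eq (Γ : SimpleGraph X) (i : ℕ) :
    primIdem Γ i = eigenProj Γ (eigenvalue Γ i) := rfl

theorem mem_spec_iff {t : ℝ} : t ∈ spec Γ ↔ Module.End.HasEigenvalue (adjOp Γ) (t : ℂ) := by
  simp [spec]

theorem adjOp_apply (w : EuclideanSpace ℂ X) :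
    adjOp Γ w = WithLp.toLp 2 ((distMatrix Γ 1).mulVec w.ofLp) := rfl

theorem mem_spec_iff_exists {t : ℝ} :
    t ∈ spec Γ ↔ ∃ w : X → ℂ, w ≠ 0 ∧ (distMatrix Γ 1).mulVec w = (t : ℂ) • w := by
  rw [mem_spec_iff]
  constructor
  · intro h
    obtain ⟨w, hw, hw0⟩ := h.exists_hasEigenvector
    rw [Module.End.mem_eigenspace_iff, adjOp_apply] at hw
    refine ⟨w.ofLp, fun h => hw0 ?_, ?_⟩
    · exact (WithLp.ofLp_injective 2) (by simpa using h)
    · have := congrArg WithLp.ofLp hw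
      simpa using this
  · rintro ⟨w, hw0, hw⟩
    refine Module.End.hasEigenvalue_of_hasEigenvector (x := WithLp.toLp 2 w) ⟨?_, ?_⟩
    · rw [Module.End.mem_eigenspace_iff, adjOp_apply]
      simp [hw]
    · simpa using hw0

theorem eigenProj_mulVec (t : ℝ) (w : X → ℂ) :
    (eigenProj Γ t).mulVec w =
      ((Module.End.eigenspace (adjOp Γ) (t : ℂ)).starProjection (WithLp.toLp 2 w)).ofLp := by
  have : Matrix.toEuclideanLin (eigenProj Γ t) (WithLp.toLp 2 w) =
      (Module.End.eigenspace (adjOp Γ) (t : ℂ)).starProjection (WithLp.toLp 2 w) := by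
    rw [eigenProj, LinearEquiv.apply_symm_apply]
    rfl
  rw [← this]
  rfl

theorem adj_mulVec_eigenProj (t : ℝ) (w : X → ℂ) :
    (distMatrix Γ 1).mulVec ((eigenProj Γ t).mulVec w) = (t : ℂ) • (eigenProj Γ t).mulVec w := by
  have h := Submodule.starProjection_apply_mem
    (Module.End.eigenspace (adjOp Γ) (t : ℂ)) (WithLp.toLp 2 w)
  rw [Module.End.mem_eigenspace_iff, adjOp_apply] at h
  rw [eigenProj_mulVec]
  simpa using congrArg WithLp.ofLp h

theorem adj_mul_eigenProj (t : ℝ) : distMatrix Γ 1 * eigenProj Γ t = t • eigenProj Γ t := by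
  apply Matrix.ext_of_mulVec_single
  intro i
  rw [← Matrix.mulVec_mulVec, adj_mulVec_eigenProj, Matrix.smul_mulVec]
  rfl

theorem adjOp_isSymmetric : (adjOp Γ).IsSymmetric := by
  rw [adjOp, Matrix.isSymmetric_toEuclideanLin_iff]
  ext y z
  rw [Matrix.conjTranspose_apply, distMatrix, Matrix.of_apply, Matrix.of_apply,
    SimpleGraph.dist_comm]
  split_ifs <;> simp

theorem sum_eigenProj : ∑ t ∈ spec Γ, eigenProj Γ t = 1 := by
  apply Matrix.ext_of_mulVec_single
  intro i
  rw [Matrix.sum_mulVec, Matrix.one_mulVec, ← Finset.sum_coe_sort]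
  have hT := adjOp_isSymmetric (Γ := Γ)
  let V : spec Γ → Submodule ℂ (EuclideanSpace ℂ X) := fun t =>
    Module.End.eigenspace (adjOp Γ) ((t : ℝ) : ℂ)
  have hV : OrthogonalFamily ℂ (fun i => V i) fun i => (V i).subtypeₗᵢ :=
    hT.orthogonalFamily_eigenspaces.comp (f := fun t : spec Γ => ((t : ℝ) : ℂ))
      (Complex.ofReal_injective.comp Subtype.val_injective)
  have htop : iSup V = ⊤ := by
    rw [← Submodule.orthogonal_eq_bot_iff, eq_bot_iff,
      ← hT.orthogonalComplement_iSup_eigenspaces_eq_bot]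
    apply Submodule.orthogonal_le
    apply iSup_le
    intro μ
    by_cases hμ : Module.End.HasEigenvalue (adjOp Γ) μ
    · have hre := Complex.conj_eq_iff_re.1 (hT.conj_eigenvalue_eq_self hμ)
      have : μ.re ∈ spec Γ := by rwa [mem_spec_iff, hre]
      refine le_trans (le_of_eq ?_) (le_iSup V ⟨μ.re, this⟩)
      simp only [V, hre]
    · rw [Module.End.hasEigenvalue_iff, not_not] at hμ
      rw [hμ]
      exact bot_le
  have := hV.sum_projection_of_mem_iSup (WithLp.toLp 2 (Pi.single i 1)) (by rw [htop]; trivial)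
  have h2 := congrArg WithLp.ofLp this
  rw [WithLp.ofLp_sum] at h2
  simp only [eigenProj_mulVec]
  exact h2

theorem eigenProj_ne_zero {t : ℝ} (ht : t ∈ spec Γ) : eigenProj Γ t ≠ 0 := by
  intro h
  rw [mem_spec_iff, Module.End.hasEigenvalue_iff] at ht
  apply ht
  rw [eq_bot_iff]
  intro w hw
  have h1 := eigenProj_mulVec (Γ := Γ) t w.ofLp
  rw [h, Matrix.zero_mulVec] at h1
  have h2 : (Module.End.eigenspace (adjOp Γ) (t : ℂ)).starProjection w = w :=
    Submodule.starProjection_eq_self_iff.2 hw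
  have h3 : (0 : X → ℂ) = w.ofLp := h1.trans (congrArg WithLp.ofLp h2)
  exact (WithLp.ofLp_injective 2) (by simpa using h3.symm)

theorem star_dotProduct_eigenProj (t : ℝ) (w : X → ℂ) :
    star w ⬝ᵥ (eigenProj Γ t).mulVec w =
      ((‖(Module.End.eigenspace (adjOp Γ) (t : ℂ)).starProjection (WithLp.toLp 2 w)‖ ^ 2 : ℝ) :
        ℂ) := by
  set U := Module.End.eigenspace (adjOp Γ) (t : ℂ)
  set w' : EuclideanSpace ℂ X := WithLp.toLp 2 w
  have h1 : star w ⬝ᵥ (eigenProj Γ t).mulVec w = inner ℂ w' (U.starProjection w') := by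
    rw [EuclideanSpace.inner_eq_star_dotProduct, eigenProj_mulVec, dotProduct_comm]
  have h2 : U.starProjection w' = U.starProjection (U.starProjection w') :=
    (Submodule.starProjection_eq_self_iff.2 (Submodule.starProjection_apply_mem U w')).symm
  rw [h1, h2, ← Submodule.inner_starProjection_left_eq_right, inner_self_eq_norm_sq_to_K, ← h2]
  simp

theorem eigenProj_mulVec_eq_zero_iff {t : ℝ} {w : X → ℂ} :
    (eigenProj Γ t).mulVec w = 0 ↔ star w ⬝ᵥ (eigenProj Γ t).mulVec w = 0 := by
  constructor
  · intro h
    rw [h, dotProduct_zero]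
  · intro h
    rw [star_dotProduct_eigenProj] at h
    have h2 : (Module.End.eigenspace (adjOp Γ) (t : ℂ)).starProjection (WithLp.toLp 2 w) = 0 := by
      simpa using h
    rw [eigenProj_mulVec, h2]
    rfl

theorem eigenProj_diag (t : ℝ) (y : X) : ∃ r : ℝ, 0 ≤ r ∧ eigenProj Γ t y y = r := by
  have h := star_dotProduct_eigenProj (Γ := Γ) t (Pi.single y 1)
  refine ⟨‖(Module.End.eigenspace (adjOp Γ) (t : ℂ)).starProjection
    (WithLp.toLp 2 (Pi.single y 1))‖ ^ 2, sq_nonneg _, ?_⟩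
  rw [← h]
  simp

theorem aeval_mul_eigenProj (q : ℝ[X]) (t : ℝ) :
    aeval (distMatrix Γ 1) q * eigenProj Γ t = q.eval t • eigenProj Γ t := by
  induction q using Polynomial.induction_on' with
  | add q r hq hr => rw [map_add, add_mul, hq, hr, eval_add, add_smul]
  | monomial n a =>
    induction n with
    | zero => simp [Algebra.algebraMap_eq_smul_one]
    | succ n ih =>
      rw [← X_mul_monomial, map_mul, aeval_X, mul_assoc, ih, mul_smul_comm, adj_mul_eigenProj,
        smul_smul, eval_mul, eval_X, mul_comm]

theorem aeval_eq_sum (q : ℝ[X]) :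
    aeval (distMatrix Γ 1) q = ∑ t ∈ spec Γ, q.eval t • eigenProj Γ t := by
  rw [← mul_one (aeval (distMatrix Γ 1) q), ← sum_eigenProj, Finset.mul_sum]
  exact Finset.sum_congr rfl fun t _ => aeval_mul_eigenProj q t

/-- Lagrange interpolation on the spectrum. Thus the projections preserve every `A`-invariant
subspace, and their entries depend only on distance. -/
theorem exists_aeval_eq_eigenProj {t : ℝ} (ht : t ∈ spec Γ) :
    ∃ q : ℝ[X], aeval (distMatrix Γ 1) q = eigenProj Γ t := by
  refine ⟨Lagrange.basis (spec Γ) id t, ?_⟩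
  rw [aeval_eq_sum, Finset.sum_eq_single t]
  · have := Lagrange.eval_basis_self (Set.injOn_id (spec Γ : Set ℝ)) ht
    rw [id] at this
    rw [this, one_smul]
  · intro s hs hst
    have := Lagrange.eval_basis_of_ne (v := id) hst.symm hs
    rw [id] at this
    rw [this, zero_smul]
  · exact fun h => absurd ht h

/-- The entries of a primitive idempotent, and their three-term recurrence. -/
theorem exists_eigenProj_eq (hΓ : IsDistanceRegular Γ) (hb : Γ.IsBipartite) {t : ℝ}
    (ht : t ∈ spec Γ) :
    ∃ F : ℕ → ℂ, F 0 ≠ 0 ∧ (∀ y z, eigenProj Γ t y z = F (Γ.dist y z)) ∧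
      ∀ i ≤ Γ.diam, c Γ i * F (i - 1) + b Γ i * F (i + 1) = t * F i := by
  obtain ⟨q, hq⟩ := exists_aeval_eq_eigenProj ht
  obtain ⟨F, hF⟩ := exists_aeval_eq hΓ hb q
  rw [hq] at hF
  have hrec : ∀ i ≤ Γ.diam, c Γ i * F (i - 1) + b Γ i * F (i + 1) = t * F i := by
    intro i hi
    obtain ⟨y, z, hyz⟩ := exists_dist_eq hΓ.1 hi
    have h1 := congrFun (congrFun (adj_mul_eigenProj (Γ := Γ) t) y) z
    rw [hF, adj_mul_of hΓ hb, hyz] at h1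
    rw [h1]
    simp [hyz]
  refine ⟨F, fun h0 => ?_, fun y z => by rw [hF]; rfl, hrec⟩
  -- Since `b_i ≠ 0` for `i < D`, the recurrence propagates the zero at distance `0` to all
  -- distances, making the projection vanish.
  have hall : ∀ i ≤ Γ.diam, F i = 0 := by
    intro i
    induction i using Nat.twoStepInduction with
    | zero => exact fun _ => h0
    | one =>
      intro hi
      have h := hrec 0 (by omega)
      have hb := (b_pos hΓ (i := 0) (by omega)).ne'
      rw [h0, c_zero] at h
      simpa [hb] using h
    | more i ih1 ih2 =>
      intro hi
      have h := hrec (i + 1) (by omega)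
      have hb := (b_pos hΓ (i := i + 1) (by omega)).ne'
      rw [ih2 (by omega), Nat.add_sub_cancel, ih1 (by omega)] at h
      simpa [hb] using h
  apply eigenProj_ne_zero ht
  rw [hF]
  ext y z
  exact hall _ (dist_le_diam hΓ.1 y z)

/-- The upper bound comes from the annihilator of degree `D + 1`; the lower one from `∏ (X - t)`
over the spectrum, which annihilates `A` and so has degree above `D`. -/
theorem card_spec (hΓ : IsDistanceRegular Γ) (hb : Γ.IsBipartite) (hD : 1 ≤ Γ.diam) :
    (spec Γ).card = Γ.diam + 1 := by
  apply le_antisymm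
  · obtain ⟨q, hq, hq0⟩ := exists_annihilator hΓ hb hD
    have hne : q ≠ 0 := by
      rintro rfl
      rw [degree_zero] at hq
      exact WithBot.bot_ne_coe hq
    have hsub : spec Γ ⊆ q.roots.toFinset := by
      intro t ht
      rw [Multiset.mem_toFinset, mem_roots hne, IsRoot.def]
      have h := aeval_mul_eigenProj (Γ := Γ) q t
      rw [hq0, zero_mul] at h
      exact (smul_eq_zero.1 h.symm).resolve_right (eigenProj_ne_zero ht)
    calc (spec Γ).card ≤ q.roots.toFinset.card := Finset.card_le_card hsub
      _ ≤ q.roots.card := Multiset.toFinset_card_le _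
      _ ≤ q.natDegree := card_roots' q
      _ = Γ.diam + 1 := natDegree_eq_of_degree_eq_some hq
  · have h := diam_lt_degree hΓ (q := ∏ t ∈ spec Γ, (Polynomial.X - C t))
      (monic_prod_of_monic _ _ fun t _ => monic_X_sub_C t).ne_zero (by
        rw [aeval_eq_sum]
        refine Finset.sum_eq_zero fun t ht => ?_
        rw [eval_prod, Finset.prod_eq_zero ht (by simp), zero_smul])
    rw [natDegree_prod_of_monic _ _ fun t _ => monic_X_sub_C t] at h
    simpa using h

/-- Flipping the sign of an eigenvector on one colour class negates its eigenvalue. -/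
theorem neg_mem_spec (hΓ : IsDistanceRegular Γ) (hb : Γ.IsBipartite) {t : ℝ} (ht : t ∈ spec Γ) :
    -t ∈ spec Γ := by
  obtain ⟨x⟩ := hΓ.1.nonempty
  rw [mem_spec_iff_exists] at ht ⊢
  obtain ⟨w, hw0, hw⟩ := ht
  refine ⟨fun y => (-1) ^ Γ.dist x y * w y, fun h => hw0 ?_, ?_⟩
  · ext y
    have := congrFun h y
    simpa using this
  · ext y
    have h1 := congrFun hw y
    simp only [Matrix.mulVec, dotProduct, Pi.smul_apply, smul_eq_mul] at h1 ⊢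
    rw [Complex.ofReal_neg, neg_mul, mul_left_comm, ← h1, Finset.mul_sum, ← Finset.sum_neg_distrib]
    refine Finset.sum_congr rfl fun z _ => ?_
    simp only [distMatrix, Matrix.of_apply]
    split_ifs with hyz
    · rw [SimpleGraph.dist_comm (u := x) (v := y), SimpleGraph.dist_comm (u := x) (v := z)]
      rcases dist_of_adj hΓ.1 hb x hyz with h | h
      · rw [h, pow_succ]; ring
      · rw [← h, pow_succ]; ring
    · simp

theorem valency_mem_spec (hΓ : IsDistanceRegular Γ) (hb : Γ.IsBipartite) : b Γ 0 ∈ spec Γ := by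
  obtain ⟨x⟩ := hΓ.1.nonempty
  rw [mem_spec_iff_exists]
  refine ⟨fun _ => 1, fun h => one_ne_zero (congrFun h x), ?_⟩
  ext y
  rw [← sum_adj_row hΓ hb y]
  simp [Matrix.mulVec, dotProduct, distMatrix]

/-- Compare both sides of the eigenvector equation at an entry of maximal modulus. -/
theorem abs_le_of_mem_spec (hΓ : IsDistanceRegular Γ) (hb : Γ.IsBipartite) {t : ℝ}
    (ht : t ∈ spec Γ) : |t| ≤ b Γ 0 := by
  have : Nonempty X := hΓ.1.nonempty
  rw [mem_spec_iff_exists] at ht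
  obtain ⟨w, hw0, hw⟩ := ht
  obtain ⟨y, hy⟩ := Finite.exists_max fun y => ‖w y‖
  have hpos : 0 < ‖w y‖ := by
    by_contra! h
    apply hw0
    ext z
    exact norm_le_zero_iff.1 ((hy z).trans h)
  have h1 := congrArg norm (congrFun hw y)
  rw [Pi.smul_apply, norm_smul, Complex.norm_real, Real.norm_eq_abs] at h1
  refine le_of_mul_le_mul_right ?_ hpos
  rw [← h1, ← sum_adj_row hΓ hb y, Finset.sum_mul]
  refine (norm_sum_le _ _).trans (Finset.sum_le_sum fun z _ => ?_)
  simp only [distMatrix, Matrix.of_apply]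
  split_ifs
  · simpa using hy z
  · simp

section Ordering

theorem length_sort_spec (hΓ : IsDistanceRegular Γ) (hb : Γ.IsBipartite) (hD : 1 ≤ Γ.diam) :
    ((spec Γ).sort (fun s t => t ≤ s)).length = Γ.diam + 1 := by
  rw [Finset.length_sort, card_spec hΓ hb hD]

theorem eigenvalue_eq_getElem {j : ℕ} (hj : j < ((spec Γ).sort (fun s t => t ≤ s)).length) :
    eigenvalue Γ j = ((spec Γ).sort (fun s t => t ≤ s))[j] := by
  rw [eigenvalue, List.getD_eq_getElem]
  rfl

theorem eigenvalue_mem_spec (hΓ : IsDistanceRegular Γ) (hb : Γ.IsBipartite) (hD : 1 ≤ Γ.diam)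
    {j : ℕ} (hj : j ≤ Γ.diam) : eigenvalue Γ j ∈ spec Γ := by
  rw [eigenvalue_eq_getElem (by rw [length_sort_spec hΓ hb hD]; omega),
    ← Finset.mem_sort (fun s t => t ≤ s)]
  exact List.getElem_mem _

theorem exists_eigenvalue_eq (hΓ : IsDistanceRegular Γ) (hb : Γ.IsBipartite) (hD : 1 ≤ Γ.diam)
    {t : ℝ} (ht : t ∈ spec Γ) : ∃ j ≤ Γ.diam, eigenvalue Γ j = t := by
  rw [← Finset.mem_sort (fun s t => t ≤ s)] at ht
  obtain ⟨j, hj, h⟩ := List.getElem_of_mem ht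
  refine ⟨j, ?_, by rw [eigenvalue_eq_getElem hj, h]⟩
  rw [length_sort_spec hΓ hb hD] at hj
  omega

theorem eigenvalue_lt (hΓ : IsDistanceRegular Γ) (hb : Γ.IsBipartite) (hD : 1 ≤ Γ.diam)
    {i j : ℕ} (hij : i < j) (hj : j ≤ Γ.diam) : eigenvalue Γ j < eigenvalue Γ i := by
  have hl := length_sort_spec hΓ hb hD
  rw [eigenvalue_eq_getElem (by omega), eigenvalue_eq_getElem (by omega)]
  refine lt_of_le_of_ne ?_ ?_
  · exact List.pairwise_iff_getElem.1 (Finset.pairwise_sort (spec Γ) (fun s t => t ≤ s)) i j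
      (by omega) (by omega) hij
  · intro h
    have := (List.Nodup.getElem_inj_iff (Finset.sort_nodup (spec Γ) (fun s t => t ≤ s))).1 h
    omega

theorem eigenvalue_sub (hΓ : IsDistanceRegular Γ) (hb : Γ.IsBipartite) (hD : 1 ≤ Γ.diam)
    {j : ℕ} (hj : j ≤ Γ.diam) : eigenvalue Γ (Γ.diam - j) = -eigenvalue Γ j := by
  have hl := length_sort_spec hΓ hb hD
  rw [eigenvalue_eq_getElem (by omega), eigenvalue_eq_getElem (by omega)]
  set l := (spec Γ).sort (fun s t => t ≤ s) with hldef
  have hnd : l.Nodup := Finset.sort_nodup (spec Γ) (fun s t => t ≤ s)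
  have hs : l.Pairwise (fun s t => t ≤ s) := Finset.pairwise_sort (spec Γ) (fun s t => t ≤ s)
  have hmem : ∀ t, t ∈ l ↔ t ∈ spec Γ := fun t => Finset.mem_sort _
  -- The spectrum is symmetric about `0`, so negating and reversing gives a sorted list with the
  -- same members, hence the same list.
  have heq : (l.map fun t => -t).reverse = l := by
    refine List.Perm.eq_of_pairwise (le := fun s t => t ≤ s)
      (fun a b _ _ h1 h2 => le_antisymm h2 h1) ?_ hs ?_
    · rw [List.pairwise_reverse, List.pairwise_map]
      exact hs.imp fun h => neg_le_neg h
    · refine (List.perm_ext_iff_of_nodup ?_ hnd).2 fun t => ?_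
      · exact List.nodup_reverse.2 (hnd.map neg_injective)
      · rw [List.mem_reverse, List.mem_map]
        constructor
        · rintro ⟨s, h, rfl⟩
          rw [hmem] at h ⊢
          exact neg_mem_spec hΓ hb h
        · intro h
          refine ⟨-t, ?_, neg_neg t⟩
          rw [hmem] at h ⊢
          exact neg_mem_spec hΓ hb h
  have h1 : l[j]'(by omega) = -l[Γ.diam - j]'(by omega) := by
    have h2 : l[j]'(by omega) = (l.map fun t => -t).reverse[j]'(by simp; omega) := by
      simp only [heq]
    rw [h2, List.getElem_reverse, List.getElem_map]
    congr 2
    simp only [List.length_map]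
    omega
  rw [h1, neg_neg]

theorem eigenvalue_zero (hΓ : IsDistanceRegular Γ) (hb : Γ.IsBipartite) (hD : 1 ≤ Γ.diam) :
    eigenvalue Γ 0 = b Γ 0 := by
  apply le_antisymm
  · exact (le_abs_self _).trans
      (abs_le_of_mem_spec hΓ hb (eigenvalue_mem_spec hΓ hb hD (Nat.zero_le _)))
  · obtain ⟨j, hj, h⟩ := exists_eigenvalue_eq hΓ hb hD (valency_mem_spec hΓ hb)
    rw [← h]
    rcases Nat.eq_zero_or_pos j with rfl | h0
    · exact le_rfl
    · exact (eigenvalue_lt hΓ hb hD h0 hj).le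

theorem sum_spec (hΓ : IsDistanceRegular Γ) (hb : Γ.IsBipartite) (hD : 1 ≤ Γ.diam)
    {M : Type*} [AddCommMonoid M] (φ : ℝ → M) :
    ∑ t ∈ spec Γ, φ t = ∑ j ∈ Finset.range (Γ.diam + 1), φ (eigenvalue Γ j) := by
  symm
  refine Finset.sum_bij (fun j _ => eigenvalue Γ j) ?_ ?_ ?_ ?_
  · intro j hj
    exact eigenvalue_mem_spec hΓ hb hD (Nat.lt_succ_iff.1 (Finset.mem_range.1 hj))
  · intro i hi j hj h
    rw [Finset.mem_range] at hi hj
    rcases lt_trichotomy i j with h1 | h1 | h1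
    · have := eigenvalue_lt hΓ hb hD h1 (by omega)
      exact absurd h this.ne'
    · exact h1
    · have := eigenvalue_lt hΓ hb hD h1 (by omega)
      exact absurd h this.ne
  · intro t ht
    obtain ⟨j, hj, h⟩ := exists_eigenvalue_eq hΓ hb hD ht
    exact ⟨j, Finset.mem_range.2 (by omega), h⟩
  · exact fun _ _ => rfl

end Ordering

end Spectrum

/-! ### The vectors `up_i`, `lo_i` and the action of `A` on them. -/

section Modules

open scoped Matrix

variable {X : Type*} {Γ : SimpleGraph X} {x : X}

/-- The vector `w` is supported on the vertices at distance `m` from `x`. -/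
def SupportedAt {X : Type*} (Γ : SimpleGraph X) (x : X) (m : ℕ) (w : X → ℂ) :
    Prop :=
  ∀ z, Γ.dist x z ≠ m → w z = 0

theorem linearIndependent_of_supportedAt {ι : Type*} {m : ι → ℕ} (hm : Function.Injective m)
    {u : ι → X → ℂ} (hu : ∀ i, SupportedAt Γ x (m i) (u i)) (h0 : ∀ i, u i ≠ 0) :
    LinearIndependent ℂ u := by
  rw [linearIndependent_iff']
  intro s a ha i hi
  obtain ⟨z, hz⟩ := Function.ne_iff.1 (h0 i)
  have h := congrFun ha z
  rw [Finset.sum_apply, Finset.sum_eq_single i] at h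
  · simpa [show u i z ≠ 0 from hz] using h
  · intro j _ hji
    have hz' : Γ.dist x z = m i := by
      by_contra hne
      exact hz (hu i z hne)
    rw [Pi.smul_apply, hu j z (by rw [hz']; exact fun h => hji (hm h.symm)), smul_zero]
  · exact fun h => absurd hi h

variable [Fintype X] [DecidableEq X]

theorem dualIdem_mulVec_apply (i : ℕ) (w : X → ℂ) (z : X) :
    (dualIdem Γ x i *ᵥ w) z = if Γ.dist x z = i then w z else 0 := by
  rw [dualIdem, Matrix.mulVec_diagonal]
  simp

theorem supportedAt_dualIdem (i : ℕ) (w : X → ℂ) : SupportedAt Γ x i (dualIdem Γ x i *ᵥ w) :=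
  fun z hz => by rw [dualIdem_mulVec_apply, if_neg hz]

theorem SupportedAt.dualIdem_self {m : ℕ} {w : X → ℂ} (h : SupportedAt Γ x m w) :
    dualIdem Γ x m *ᵥ w = w := by
  ext z
  rw [dualIdem_mulVec_apply]
  split_ifs with hz
  · rfl
  · exact (h z hz).symm

theorem SupportedAt.dualIdem_of_ne {m j : ℕ} {w : X → ℂ} (h : SupportedAt Γ x m w) (hj : j ≠ m) :
    dualIdem Γ x j *ᵥ w = 0 := by
  ext z
  rw [dualIdem_mulVec_apply]
  split_ifs with hz
  · exact h z (hz ▸ hj)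
  · rfl

theorem SupportedAt.dualIdem_adj (hΓ : IsDistanceRegular Γ) (hb : Γ.IsBipartite) {m j : ℕ}
    {w : X → ℂ} (h : SupportedAt Γ x m w) (h1 : j ≠ m + 1) (h2 : j + 1 ≠ m) :
    dualIdem Γ x j *ᵥ (distMatrix Γ 1 *ᵥ w) = 0 := by
  ext z
  rw [dualIdem_mulVec_apply]
  split_ifs with hz
  · rw [Matrix.mulVec, dotProduct]
    refine Finset.sum_eq_zero fun y _ => ?_
    by_cases hy : Γ.dist x y = m
    · have : Γ.dist z y ≠ 1 := by
        intro h
        have := dist_of_adj hΓ.1 hb x h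
        rw [SimpleGraph.dist_comm (v := x), SimpleGraph.dist_comm (v := x)] at this
        omega
      simp [distMatrix, this]
    · rw [h y hy, mul_zero]
  · rfl

theorem SupportedAt.adj_eq (hΓ : IsDistanceRegular Γ) (hb : Γ.IsBipartite) {m : ℕ}
    {w : X → ℂ} (h : SupportedAt Γ x (m + 1) w) :
    distMatrix Γ 1 *ᵥ w = dualIdem Γ x (m + 2) *ᵥ (distMatrix Γ 1 *ᵥ w) +
      dualIdem Γ x m *ᵥ (distMatrix Γ 1 *ᵥ w) := by
  ext z
  rw [Pi.add_apply, dualIdem_mulVec_apply, dualIdem_mulVec_apply]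
  by_cases h1 : Γ.dist x z = m + 2
  · simp [h1]
  · by_cases h2 : Γ.dist x z = m
    · simp [h2]
    · have := congrFun (h.dualIdem_adj hΓ hb (j := Γ.dist x z) (by omega) (by omega)) z
      rw [dualIdem_mulVec_apply, if_pos rfl] at this
      simp [h1, h2, this]

theorem isTModule_of {W : Submodule ℂ (X → ℂ)} (hA : ∀ w ∈ W, distMatrix Γ 1 *ᵥ w ∈ W)
    (hE : ∀ i, ∀ w ∈ W, dualIdem Γ x i *ᵥ w ∈ W) : IsTModule Γ x W := by
  let S : Subalgebra ℂ (Matrix X X ℂ) :=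
    { carrier := {B | ∀ w ∈ W, B *ᵥ w ∈ W}
      mul_mem' := fun {B C} hB hC w hw => by
        rw [← Matrix.mulVec_mulVec]
        exact hB _ (hC _ hw)
      add_mem' := fun {B C} hB hC w hw => by
        rw [Matrix.add_mulVec]
        exact W.add_mem (hB _ hw) (hC _ hw)
      algebraMap_mem' := fun r w hw => by
        rw [Algebra.algebraMap_eq_smul_one, Matrix.smul_mulVec, Matrix.one_mulVec]
        exact W.smul_mem r hw }
  have : subconstituentAlgebra Γ x ≤ S := by
    refine sup_le (Algebra.adjoin_le ?_) (Algebra.adjoin_le ?_)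
    · rintro _ rfl
      exact hA
    · rintro _ ⟨i, rfl⟩
      exact hE i
  exact fun B hB => this hB

theorem IsTModule.adj_mem {W : Submodule ℂ (X → ℂ)} (h : IsTModule Γ x W) {w : X → ℂ}
    (hw : w ∈ W) : distMatrix Γ 1 *ᵥ w ∈ W :=
  h _ ((le_sup_left : boseMesner Γ ≤ subconstituentAlgebra Γ x)
    (Algebra.subset_adjoin rfl)) w hw

theorem IsTModule.dualIdem_mem {W : Submodule ℂ (X → ℂ)} (h : IsTModule Γ x W) (i : ℕ)
    {w : X → ℂ} (hw : w ∈ W) : dualIdem Γ x i *ᵥ w ∈ W :=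
  h _ ((le_sup_right : dualBoseMesner Γ x ≤ subconstituentAlgebra Γ x)
    (Algebra.subset_adjoin ⟨i, rfl⟩)) w hw

theorem aeval_mulVec_mem {W : Submodule ℂ (X → ℂ)}
    (h : ∀ w ∈ W, distMatrix Γ 1 *ᵥ w ∈ W) (q : ℝ[X])
    {w : X → ℂ} (hw : w ∈ W) : aeval (distMatrix Γ 1) q *ᵥ w ∈ W := by
  induction q using Polynomial.induction_on' with
  | add q r hq hr =>
    rw [map_add, Matrix.add_mulVec]
    exact W.add_mem hq hr
  | monomial n a =>
    induction n with
    | zero =>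
      rw [monomial_zero_left, aeval_C, Algebra.algebraMap_eq_smul_one, Matrix.smul_mulVec,
        Matrix.one_mulVec]
      exact W.smul_mem (a : ℂ) hw
    | succ n ih =>
      rw [← X_mul_monomial, map_mul, aeval_X, ← Matrix.mulVec_mulVec]
      exact h _ ih

/-- A nonzero vector `v` of `E*_2 W`, for a `T`-module `W` with `E*_0 W = E*_1 W = 0`. -/
structure IsEndpointTwoVector (Γ : SimpleGraph X) (x : X) (W : Submodule ℂ (X → ℂ))
    (v : X → ℂ) : Prop where
  distanceRegular : IsDistanceRegular Γ
  bipartite : Γ.IsBipartite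
  four_le_diam : 4 ≤ Γ.diam
  isTModule : IsTModule Γ x W
  eq_zero_of_lt : ∀ w ∈ W, ∀ z, Γ.dist x z < 2 → w z = 0
  mem : v ∈ W
  supported : SupportedAt Γ x 2 v
  ne_zero : v ≠ 0

/-- The vector `E*_{i+2} A_i v`. -/
noncomputable def up (Γ : SimpleGraph X) (x : X) (v : X → ℂ) (i : ℕ) : X → ℂ :=
  (dualIdem Γ x (i + 2) * distMatrix Γ i) *ᵥ v

/-- The vector `E*_i A_{i+2} v`. -/
noncomputable def lo (Γ : SimpleGraph X) (x : X) (v : X → ℂ) (i : ℕ) : X → ℂ :=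
  (dualIdem Γ x i * distMatrix Γ (i + 2)) *ᵥ v

theorem supportedAt_up (v : X → ℂ) (i : ℕ) : SupportedAt Γ x (i + 2) (up Γ x v i) := by
  rw [up, ← Matrix.mulVec_mulVec]
  exact supportedAt_dualIdem _ _

theorem supportedAt_lo (v : X → ℂ) (i : ℕ) : SupportedAt Γ x i (lo Γ x v i) := by
  rw [lo, ← Matrix.mulVec_mulVec]
  exact supportedAt_dualIdem _ _

namespace IsEndpointTwoVector

variable {W : Submodule ℂ (X → ℂ)} {v : X → ℂ}

theorem distMatrix_mem (h : IsEndpointTwoVector Γ x W v) (i : ℕ) {w : X → ℂ} (hw : w ∈ W) :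
    distMatrix Γ i *ᵥ w ∈ W := by
  rcases le_or_gt i Γ.diam with hi | hi
  · rw [← aeval_f h.distanceRegular h.bipartite hi]
    exact aeval_mulVec_mem (fun _ hw => h.isTModule.adj_mem hw) _ hw
  · rw [distMatrix_of_diam_lt h.distanceRegular hi, Matrix.zero_mulVec]
    exact W.zero_mem

theorem up_mem (h : IsEndpointTwoVector Γ x W v) (i : ℕ) : up Γ x v i ∈ W := by
  rw [up, ← Matrix.mulVec_mulVec]
  exact h.isTModule.dualIdem_mem _ (h.distMatrix_mem _ h.mem)

theorem lo_mem (h : IsEndpointTwoVector Γ x W v) (i : ℕ) : lo Γ x v i ∈ W := by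
  rw [lo, ← Matrix.mulVec_mulVec]
  exact h.isTModule.dualIdem_mem _ (h.distMatrix_mem _ h.mem)

theorem lo_of_lt (h : IsEndpointTwoVector Γ x W v) {i : ℕ} (hi : i < 2) : lo Γ x v i = 0 := by
  ext z
  by_cases hz : Γ.dist x z = i
  · exact h.eq_zero_of_lt _ (h.lo_mem i) z (hz ▸ hi)
  · exact supportedAt_lo v i z hz

theorem up_zero (h : IsEndpointTwoVector Γ x W v) : up Γ x v 0 = v := by
  rw [up, distMatrix_zero h.distanceRegular, mul_one, h.supported.dualIdem_self]

/-- The sum is the `x`-entry of `A_2 v`, which lies in `W` and so vanishes at `x`. -/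
theorem sum_eq_zero (h : IsEndpointTwoVector Γ x W v) : ∑ y, v y = 0 := by
  have h1 := h.eq_zero_of_lt _ (h.distMatrix_mem 2 h.mem) x (by simp)
  rw [← h1, Matrix.mulVec, dotProduct]
  refine Finset.sum_congr rfl fun y _ => ?_
  by_cases hy : Γ.dist x y = 2
  · simp [distMatrix, hy]
  · rw [h.supported y hy, mul_zero]

theorem dist_cases (h : IsEndpointTwoVector Γ x W v) {y z : X} (hy : Γ.dist x y = 2) :
    Γ.dist z y + 2 = Γ.dist x z ∨ Γ.dist z y = Γ.dist x z ∨ Γ.dist z y = Γ.dist x z + 2 ∨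
      (Γ.dist x z = 1 ∧ Γ.dist z y = 1) := by
  have h1 := h.distanceRegular.1.dist_triangle (u := x) (v := z) (w := y)
  have h2 := h.distanceRegular.1.dist_triangle (u := x) (v := y) (w := z)
  have h3 := h.distanceRegular.1.dist_triangle (u := z) (v := x) (w := y)
  obtain ⟨r, hr⟩ := even_dist_add h.distanceRegular.1 h.bipartite x z y
  rw [SimpleGraph.dist_comm (u := y) (v := z)] at h2
  rw [SimpleGraph.dist_comm (u := z) (v := x)] at h3
  omega

theorem sum_dist (h : IsEndpointTwoVector Γ x W v) (G : ℕ → ℂ) {i : ℕ} {z : X}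
    (hz : Γ.dist x z = i + 2) :
    ∑ y, G (Γ.dist z y) * v y = G i * (distMatrix Γ i *ᵥ v) z +
      G (i + 2) * (distMatrix Γ (i + 2) *ᵥ v) z + G (i + 4) * (distMatrix Γ (i + 4) *ᵥ v) z := by
  simp only [Matrix.mulVec, dotProduct, Finset.mul_sum, ← Finset.sum_add_distrib]
  refine Finset.sum_congr rfl fun y _ => ?_
  by_cases hy : Γ.dist x y = 2
  · simp only [distMatrix, Matrix.of_apply]
    rcases h.dist_cases (z := z) hy with h1 | h1 | h1 | h1
    · rw [show Γ.dist z y = i by omega]; simp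
    · rw [show Γ.dist z y = i + 2 by omega]; simp
    · rw [show Γ.dist z y = i + 4 by omega]; simp
    · omega
  · simp [h.supported y hy]

/-- This is `∑ v = 0` sorted by distance from `z`: the support of `v` meets only distances `i`, `i +
2` and `i + 4`. -/
theorem middle (h : IsEndpointTwoVector Γ x W v) {i : ℕ} {z : X} (hz : Γ.dist x z = i + 2) :
    (distMatrix Γ i *ᵥ v) z + (distMatrix Γ (i + 2) *ᵥ v) z + (distMatrix Γ (i + 4) *ᵥ v) z =
      0 := by
  have := h.sum_dist (fun _ => 1) hz
  simp only [one_mul] at this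
  rw [← this, h.sum_eq_zero]

theorem distMatrix_mulVec_eq_zero (h : IsEndpointTwoVector Γ x W v) {i : ℕ} {z : X}
    (h1 : Γ.dist x z ≠ i) (h2 : Γ.dist x z ≠ i + 2) (h3 : Γ.dist x z + 2 ≠ i) :
    (distMatrix Γ i *ᵥ v) z = 0 := by
  rcases lt_or_ge (Γ.dist x z) 2 with hlt | hge
  · exact h.eq_zero_of_lt _ (h.distMatrix_mem i h.mem) z hlt
  · rw [Matrix.mulVec, dotProduct]
    refine Finset.sum_eq_zero fun y _ => ?_
    by_cases hy : Γ.dist x y = 2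
    · have : Γ.dist z y ≠ i := by
        rcases h.dist_cases (z := z) hy with h1 | h1 | h1 | h1 <;> omega
      simp [distMatrix, this]
    · rw [h.supported y hy, mul_zero]

/-- The outer spheres `i` and `i + 4` carry `lo_i` and `up_{i+2}`. On the sphere `i + 2`, `middle`
trades `A_{i+2} v` for `-up_i - lo_{i+2}`. The result telescopes when summed to `p_i(A) v`. -/
theorem distMatrix_add_two (h : IsEndpointTwoVector Γ x W v) (i : ℕ) :
    distMatrix Γ (i + 2) *ᵥ v =
      lo Γ x v i - up Γ x v i - lo Γ x v (i + 2) + up Γ x v (i + 2) := by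
  ext z
  simp only [Pi.add_apply, Pi.sub_apply, lo, up, ← Matrix.mulVec_mulVec, dualIdem_mulVec_apply]
  by_cases h1 : Γ.dist x z = i
  · simp [h1]
    omega
  · by_cases h2 : Γ.dist x z = i + 2
    · have := h.middle h2
      simp only [h2, if_true]
      simp
      linear_combination this
    · by_cases h3 : Γ.dist x z = i + 4
      · simp [h3]
      · simp [h1, h2, h3, h.distMatrix_mulVec_eq_zero (i := i + 2) h2 h3 (by omega)]

theorem aeval_p (h : IsEndpointTwoVector Γ x W v) {i : ℕ} (hi : i ≤ Γ.diam) :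
    aeval (distMatrix Γ 1) (p Γ i) *ᵥ v = up Γ x v i - lo Γ x v i := by
  induction i using Nat.twoStepInduction with
  | zero => rw [p_zero, map_one, Matrix.one_mulVec, h.lo_of_lt two_pos, h.up_zero, sub_zero]
  | one =>
    rw [p_one, f_one h.distanceRegular hi, aeval_X, h.lo_of_lt one_lt_two, sub_zero, up,
      ← Matrix.mulVec_mulVec, SupportedAt.dualIdem_self]
    intro z hz
    by_cases h1 : Γ.dist x z = 1
    · exact h.eq_zero_of_lt _ (h.distMatrix_mem 1 h.mem) z (by omega)
    · exact h.distMatrix_mulVec_eq_zero h1 hz (by omega)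
  | more i ih _ =>
    rw [p_add_two, map_add, Matrix.add_mulVec, ih (by omega),
      aeval_f h.distanceRegular h.bipartite hi, h.distMatrix_add_two]
    abel

/-- `X_mul_p` evaluated at `A` and applied to `v`. The next three lemmas are its components on the
spheres `i + 4`, `i` and `i + 2`. -/
theorem adj_mulVec_sub (h : IsEndpointTwoVector Γ x W v) {i : ℕ} (hi : i + 2 ≤ Γ.diam) :
    distMatrix Γ 1 *ᵥ up Γ x v (i + 1) - distMatrix Γ 1 *ᵥ lo Γ x v (i + 1) =
      (c Γ (i + 2) : ℂ) • (up Γ x v (i + 2) - lo Γ x v (i + 2)) +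
        (b Γ (i + 2) : ℂ) • (up Γ x v i - lo Γ x v i) := by
  have h1 := congrArg (fun q => aeval (distMatrix Γ 1) q *ᵥ v)
    (X_mul_p h.distanceRegular h.bipartite hi)
  simp only [map_mul, map_add, aeval_X, aeval_C, ← Algebra.smul_def, Matrix.add_mulVec,
    Matrix.smul_mulVec, ← Matrix.mulVec_mulVec] at h1
  rw [h.aeval_p (by omega), h.aeval_p hi, h.aeval_p (by omega), Matrix.mulVec_sub] at h1
  exact h1

theorem raise_up (h : IsEndpointTwoVector Γ x W v) {i : ℕ} (hi : i + 1 ≤ Γ.diam) :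
    dualIdem Γ x (i + 3) *ᵥ (distMatrix Γ 1 *ᵥ up Γ x v i) =
      (c Γ (i + 1) : ℂ) • up Γ x v (i + 1) := by
  rcases i with _ | i
  · rw [h.up_zero, c_one h.distanceRegular hi, up, Matrix.mulVec_mulVec]
    simp
  · have h1 := congrArg (fun w => dualIdem Γ x (i + 4) *ᵥ w) (h.adj_mulVec_sub hi)
    simp only [Matrix.mulVec_sub, Matrix.mulVec_add, Matrix.mulVec_smul] at h1
    rw [(supportedAt_lo v (i + 1)).dualIdem_adj h.distanceRegular h.bipartite (by omega) (by omega),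
      (supportedAt_up v (i + 2)).dualIdem_self,
      (supportedAt_lo v (i + 2)).dualIdem_of_ne (by omega),
      (supportedAt_lo v i).dualIdem_of_ne (by omega),
      (supportedAt_up v i).dualIdem_of_ne (by omega)] at h1
    simpa using h1

theorem lower_lo (h : IsEndpointTwoVector Γ x W v) {i : ℕ} (hi : i + 2 ≤ Γ.diam) :
    dualIdem Γ x i *ᵥ (distMatrix Γ 1 *ᵥ lo Γ x v (i + 1)) = (b Γ (i + 2) : ℂ) • lo Γ x v i := by
  have h1 := congrArg (fun w => dualIdem Γ x i *ᵥ w) (h.adj_mulVec_sub hi)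
  simp only [Matrix.mulVec_sub, Matrix.mulVec_add, Matrix.mulVec_smul] at h1
  rw [(supportedAt_up v (i + 1)).dualIdem_adj h.distanceRegular h.bipartite (by omega) (by omega),
    (supportedAt_up v (i + 2)).dualIdem_of_ne (by omega),
    (supportedAt_lo v (i + 2)).dualIdem_of_ne (by omega),
    (supportedAt_lo v i).dualIdem_self,
    (supportedAt_up v i).dualIdem_of_ne (by omega)] at h1
  simpa using h1

theorem lower_up (h : IsEndpointTwoVector Γ x W v) {i : ℕ} (hi : i + 2 ≤ Γ.diam) :
    dualIdem Γ x (i + 2) *ᵥ (distMatrix Γ 1 *ᵥ up Γ x v (i + 1)) =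
      dualIdem Γ x (i + 2) *ᵥ (distMatrix Γ 1 *ᵥ lo Γ x v (i + 1)) +
        (b Γ (i + 2) : ℂ) • up Γ x v i - (c Γ (i + 2) : ℂ) • lo Γ x v (i + 2) := by
  have h1 := congrArg (fun w => dualIdem Γ x (i + 2) *ᵥ w) (h.adj_mulVec_sub hi)
  simp only [Matrix.mulVec_sub, Matrix.mulVec_add, Matrix.mulVec_smul] at h1
  rw [(supportedAt_up v (i + 2)).dualIdem_of_ne (by omega),
    (supportedAt_lo v (i + 2)).dualIdem_self,
    (supportedAt_lo v i).dualIdem_of_ne (by omega),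
    (supportedAt_up v i).dualIdem_self] at h1
  rw [sub_eq_iff_eq_add] at h1
  rw [h1]
  simp only [zero_sub, sub_zero, smul_neg]
  abel

end IsEndpointTwoVector

end Modules

/-! ### Location of the eigenvalues relative to `b_2`. -/

section EigenvalueBounds

variable {X : Type*} [Fintype X] [DecidableEq X] {Γ : SimpleGraph X}

theorem eigenvalue_sq_lt (hΓ : IsDistanceRegular Γ) (hb : Γ.IsBipartite) {j : ℕ} (h1 : 1 ≤ j)
    (h2 : j + 1 ≤ Γ.diam) : (eigenvalue Γ j) ^ 2 < (b Γ 0) ^ 2 := by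
  have hD : 1 ≤ Γ.diam := by omega
  have e1 := eigenvalue_lt hΓ hb hD (i := 0) (j := j) (by omega) (by omega)
  have e2 := eigenvalue_lt hΓ hb hD (i := j) (j := Γ.diam - 0) (by omega) (by omega)
  rw [eigenvalue_sub hΓ hb hD (by omega)] at e2
  rw [eigenvalue_zero hΓ hb hD] at e1 e2
  exact sq_lt_sq' e2 e1

/-- The diagonal entries of `(k² - A²)(A² - b₂)` vanish. -/
theorem sum_weights (hΓ : IsDistanceRegular Γ) (hb : Γ.IsBipartite) (hD : 4 ≤ Γ.diam) (x : X) :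
    ∑ t ∈ spec Γ, (((b Γ 0 ^ 2 - t ^ 2) * (t ^ 2 - b Γ 2) : ℝ) : ℂ) * eigenProj Γ t x x = 0 := by
  have h := congrFun (congrFun (aeval_eq_sum (Γ := Γ)
    ((C (b Γ 0 ^ 2) - Polynomial.X ^ 2) * (Polynomial.X ^ 2 - C (b Γ 2)))) x) x
  have e0 : distMatrix Γ 1 * distMatrix Γ 1 =
      b Γ 0 • (1 : Matrix X X ℂ) + c Γ 2 • distMatrix Γ 2 := by
    rw [adj_mul_distMatrix hΓ hb 0, distMatrix_zero hΓ]
  have e1 : distMatrix Γ 1 * distMatrix Γ 2 = b Γ 1 • distMatrix Γ 1 + c Γ 3 • distMatrix Γ 3 :=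
    adj_mul_distMatrix hΓ hb 1
  have e2 : distMatrix Γ 1 * distMatrix Γ 3 = b Γ 2 • distMatrix Γ 2 + c Γ 4 • distMatrix Γ 4 :=
    adj_mul_distMatrix hΓ hb 2
  have hc1 := c_one hΓ (by omega)
  have hb1 := b_add_c hΓ hb (i := 1) (by omega)
  have hb2 := b_add_c hΓ hb (i := 2) (by omega)
  have hq : aeval (distMatrix Γ 1)
      ((C (b Γ 0 ^ 2) - Polynomial.X ^ 2) * (Polynomial.X ^ 2 - C (b Γ 2))) =
      (b Γ 0 ^ 2 + b Γ 2) • (distMatrix Γ 1 * distMatrix Γ 1) -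
        (b Γ 0 ^ 2 * b Γ 2) • (1 : Matrix X X ℂ) -
        distMatrix Γ 1 * (distMatrix Γ 1 * (distMatrix Γ 1 * distMatrix Γ 1)) := by
    simp only [map_mul, map_sub, map_pow, aeval_X, aeval_C, Algebra.algebraMap_eq_smul_one]
    simp only [sub_mul, mul_sub, smul_sub, smul_mul_assoc, mul_smul_comm, one_mul, mul_one, smul_smul,
      pow_two, mul_assoc, add_smul]
    module
  have e3 : distMatrix Γ 1 * (distMatrix Γ 1 * (distMatrix Γ 1 * distMatrix Γ 1)) =
      (b Γ 0 + c Γ 2 * b Γ 1) • (distMatrix Γ 1 * distMatrix Γ 1) +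
        (c Γ 2 * c Γ 3) • (distMatrix Γ 1 * distMatrix Γ 3) := by
    conv_lhs => rw [e0]
    simp only [mul_add, mul_smul_comm, mul_one, e1, smul_add, smul_smul, add_smul]
    abel
  have hdiag : ∀ i, i ≠ 0 → distMatrix Γ i x x = 0 := fun i hi => by
    simp [distMatrix, hi.symm]
  rw [hq, e3, e0, e2] at h
  simp only [Matrix.sub_apply, Matrix.add_apply, Matrix.smul_apply, Matrix.sum_apply,
    Matrix.one_apply_eq, hdiag 2 (by norm_num), hdiag 4 (by norm_num), smul_zero, add_zero,
    Complex.real_smul] at h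
  have hz : ∀ t : ℝ, eval t ((C (b Γ 0 ^ 2) - Polynomial.X ^ 2) * (Polynomial.X ^ 2 - C (b Γ 2))) =
      (b Γ 0 ^ 2 - t ^ 2) * (t ^ 2 - b Γ 2) := fun t => by simp
  simp only [hz] at h
  rw [← h]
  rw [hc1] at hb1
  have e4 : b Γ 1 = b Γ 0 - 1 := by linarith
  have e5 : c Γ 2 = b Γ 0 - b Γ 2 := by linarith
  rw [e4, e5]
  push_cast
  ring

/-- In `sum_weights` the weights `(k² - θ_j²) (E_j)_{xx}` are positive for `0 < j < D` and zero at
both ends. If all `θ_j² - b_2` had the same weak sign, every interior one would vanish. -/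
theorem eigenvalue_sq_sub_not_signed (hΓ : IsDistanceRegular Γ) (hb : Γ.IsBipartite)
    (hD : 4 ≤ Γ.diam) (s : ℝ) (hs : s ≠ 0)
    (h : ∀ j, 1 ≤ j → j + 1 ≤ Γ.diam → 0 ≤ s * (eigenvalue Γ j ^ 2 - b Γ 2)) : False := by
  have hD1 : 1 ≤ Γ.diam := by omega
  obtain ⟨x⟩ := hΓ.1.nonempty
  have hsum := sum_weights hΓ hb hD x
  choose r hr0 hr using fun t => eigenProj_diag (Γ := Γ) t x
  have hrpos : ∀ t ∈ spec Γ, 0 < r t := by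
    intro t ht
    refine lt_of_le_of_ne (hr0 t) fun h0 => ?_
    obtain ⟨F, hF0, hF, -⟩ := exists_eigenProj_eq hΓ hb ht
    apply hF0
    have := hr t
    rw [hF, SimpleGraph.dist_self, ← h0] at this
    simpa using this
  simp only [hr] at hsum
  rw [sum_spec hΓ hb hD1] at hsum
  have hsum' : ∑ j ∈ Finset.range (Γ.diam + 1), s * ((b Γ 0 ^ 2 - eigenvalue Γ j ^ 2) *
      (eigenvalue Γ j ^ 2 - b Γ 2) * r (eigenvalue Γ j)) = 0 := by
    rw [← Finset.mul_sum]
    have : ∑ j ∈ Finset.range (Γ.diam + 1), (b Γ 0 ^ 2 - eigenvalue Γ j ^ 2) *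
      (eigenvalue Γ j ^ 2 - b Γ 2) * r (eigenvalue Γ j) = 0 := by exact_mod_cast hsum
    rw [this, mul_zero]
  have hends : ∀ j, j = 0 ∨ j = Γ.diam → b Γ 0 ^ 2 - eigenvalue Γ j ^ 2 = 0 := by
    rintro j (rfl | rfl)
    · rw [eigenvalue_zero hΓ hb hD1, sub_self]
    · have := eigenvalue_sub hΓ hb hD1 (j := 0) (by omega)
      rw [Nat.sub_zero] at this
      rw [this, eigenvalue_zero hΓ hb hD1, neg_sq, sub_self]
  have hzero := (Finset.sum_eq_zero_iff_of_nonneg (fun j hj => by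
    rw [Finset.mem_range] at hj
    by_cases hj0 : j = 0 ∨ j = Γ.diam
    · rw [hends j hj0]
      simp
    · have h1 := eigenvalue_sq_lt hΓ hb (j := j) (by omega) (by omega)
      have h2 := h j (by omega) (by omega)
      have h3 := hr0 (eigenvalue Γ j)
      have : s * ((b Γ 0 ^ 2 - eigenvalue Γ j ^ 2) * (eigenvalue Γ j ^ 2 - b Γ 2) *
          r (eigenvalue Γ j)) = (b Γ 0 ^ 2 - eigenvalue Γ j ^ 2) *
          (s * (eigenvalue Γ j ^ 2 - b Γ 2)) * r (eigenvalue Γ j) := by ring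
      rw [this]
      exact mul_nonneg (mul_nonneg (sub_nonneg.2 h1.le) h2) h3)).1 hsum'
  have hsq : ∀ j, 1 ≤ j → j + 1 ≤ Γ.diam → eigenvalue Γ j ^ 2 = b Γ 2 := by
    intro j h1 h2
    have h3 := hzero j (Finset.mem_range.2 (by omega))
    have h4 := eigenvalue_sq_lt hΓ hb h1 h2
    have h5 := hrpos _ (eigenvalue_mem_spec hΓ hb hD1 (j := j) (by omega))
    have h6 := (mul_eq_zero.1 h3).resolve_left hs
    have h7 := (mul_eq_zero.1 h6).resolve_right h5.ne'
    have h8 := (mul_eq_zero.1 h7).resolve_left (sub_pos.2 h4).ne'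
    linarith
  -- Since `D ≥ 4`, the three distinct eigenvalues `θ_1`, `θ_2`, `θ_3` are interior, but a square is
  -- shared by at most two numbers.
  have l1 := eigenvalue_lt hΓ hb hD1 (i := 1) (j := 2) (by omega) (by omega)
  have l2 := eigenvalue_lt hΓ hb hD1 (i := 2) (j := 3) (by omega) (by omega)
  have q1 := hsq 1 (by omega) (by omega)
  have q2 := hsq 2 (by omega) (by omega)
  have q3 := hsq 3 (by omega) (by omega)
  rcases sq_eq_sq_iff_eq_or_eq_neg.1 (q1.trans q2.symm) with h1 | h1
  · linarith
  · rcases sq_eq_sq_iff_eq_or_eq_neg.1 (q3.trans q2.symm) with h2 | h2 <;> linarith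

theorem eigenvalue_pos (hΓ : IsDistanceRegular Γ) (hb : Γ.IsBipartite) {j : ℕ}
    (h2 : 2 * j < Γ.diam) : 0 < eigenvalue Γ j := by
  have h := eigenvalue_lt hΓ hb (by omega) (i := j) (j := Γ.diam - j) (by omega) (by omega)
  rw [eigenvalue_sub hΓ hb (by omega) (by omega)] at h
  linarith

theorem eigenvalue_anti (hΓ : IsDistanceRegular Γ) (hb : Γ.IsBipartite) (hD : 1 ≤ Γ.diam)
    {i j : ℕ} (hij : i ≤ j) (hj : j ≤ Γ.diam) : eigenvalue Γ j ≤ eigenvalue Γ i := by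
  rcases hij.eq_or_lt with rfl | h
  · exact le_rfl
  · exact (eigenvalue_lt hΓ hb hD h hj).le

/-- Among the interior eigenvalues, `θ_1²` is the largest square and, for odd `D`, `θ_{⌊D/2⌋}²` the
smallest. Equality with `b_2` would give all differences one sign. -/
theorem eigenvalue_sq_ne (hΓ : IsDistanceRegular Γ) (hb : Γ.IsBipartite) (hD : 4 ≤ Γ.diam) {n : ℕ}
    (hn : n = 1 ∨ (Odd Γ.diam ∧ n = Γ.diam / 2)) : eigenvalue Γ n ^ 2 ≠ b Γ 2 := by
  intro h
  have hD1 : 1 ≤ Γ.diam := by omega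
  rcases hn with rfl | ⟨hodd, hn⟩
  · refine eigenvalue_sq_sub_not_signed hΓ hb hD (-1) (by norm_num) fun j h1 h2 => ?_
    have e1 := eigenvalue_anti hΓ hb hD1 h1 (by omega)
    have e2 := eigenvalue_anti hΓ hb hD1 (i := j) (j := Γ.diam - 1) (by omega) (by omega)
    rw [eigenvalue_sub hΓ hb hD1 hD1] at e2
    have := sq_le_sq' e2 e1
    linarith
  · obtain ⟨d, hd⟩ := hodd
    have hnd : n = d := by omega
    refine eigenvalue_sq_sub_not_signed hΓ hb hD 1 (by norm_num) fun j h1 h2 => ?_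
    have hpos := eigenvalue_pos hΓ hb (j := n) (by omega)
    suffices eigenvalue Γ n ^ 2 ≤ eigenvalue Γ j ^ 2 by linarith
    rcases le_or_gt j n with hj | hj
    · have e1 := eigenvalue_anti hΓ hb hD1 hj (by omega)
      exact pow_le_pow_left₀ hpos.le e1 2
    · have e1 := eigenvalue_anti hΓ hb hD1 (i := Γ.diam - n) (j := j) (by omega) (by omega)
      rw [eigenvalue_sub hΓ hb hD1 (by omega)] at e1
      rw [← neg_sq (eigenvalue Γ j)]
      exact pow_le_pow_left₀ hpos.le (by linarith) 2

end EigenvalueBounds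

/-- The solution of the recurrence for the ratios between `E*_j A_{j+2} v` and `E*_j A_{j-2} v`. -/
theorem ratio_recurrence {K : Type*} [Field K] {D : ℕ} {c b P r : ℕ → K} {θ : K}
    (hb : ∀ i < D, b i ≠ 0) (hc0 : c 0 = 0) (hc1 : c 1 = 1)
    (hP0 : P 0 = 1) (hP1 : P 1 = θ) (hθ : θ ≠ 0) (hP2 : P 2 ≠ 0)
    (hP : ∀ i, i + 2 ≤ D → θ * P (i + 1) = c (i + 2) * P (i + 2) + b (i + 2) * P i)
    (hr2 : r 2 * P 2 * c 2 = b 2 * b 3)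
    (hr : ∀ m, m + 5 ≤ D → r (m + 3) * (r (m + 1) * c m + b (m + 2) - c (m + 2) * r (m + 2)) =
      b (m + 4) * r (m + 2)) (m : ℕ) (hm : m + 4 ≤ D) :
    P m ≠ 0 ∧ P (m + 2) ≠ 0 ∧
      r (m + 2) * P (m + 2) * c (m + 1) * c (m + 2) = P m * b (m + 2) * b (m + 3) := by
  induction m using Nat.twoStepInduction with
  | zero =>
    refine ⟨by simp [hP0], hP2, ?_⟩
    simp only [zero_add]
    rw [hc1, hP0]
    linear_combination hr2
  | one =>
    have h1 := hP 1 (by omega)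
    have h2 := hr 0 hm
    simp only [zero_add, Nat.reduceAdd] at h1 h2 ⊢
    have hb2 := hb 2 (by omega)
    have hb3 := hb 3 (by omega)
    have hb4 := hb 4 (by omega)
    -- The identity is kept free of division: `P 3 ≠ 0` is not known yet, but is read off afterwards
    -- from the nonzero right side. The term `r 1` drops out with `c 0 = 0`.
    have key : r 3 * P 3 * c 2 * c 3 = P 1 * b 3 * b 4 := by
      apply mul_left_cancel₀ hb2
      rw [hc0, hP1] at *
      linear_combination θ * P 2 * c 2 * h2 + (b 4 * θ + r 3 * θ * c 2) * hr2 -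
        r 3 * b 2 * c 2 * h1
    refine ⟨hP1 ▸ hθ, fun h0 => ?_, key⟩
    rw [h0, hP1] at key
    simp only [mul_zero, zero_mul] at key
    exact mul_ne_zero (mul_ne_zero hθ hb3) hb4 key.symm
  | more m ih1 ih2 =>
    obtain ⟨hPm, hPm2, e2⟩ := ih1 (by omega)
    obtain ⟨hPm1, hPm3, e3⟩ := ih2 (by omega)
    have h1 := hP m (by omega)
    have h3 := hP (m + 2) (by omega)
    have h2 := hr (m + 1) (by omega)
    simp only [show m + 1 + 1 = m + 2 from rfl, show m + 1 + 2 = m + 3 from rfl,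
      show m + 1 + 3 = m + 4 from rfl, show m + 1 + 4 = m + 5 from rfl] at *
    have hb3 := hb (m + 3) (by omega)
    have hb4 := hb (m + 4) (by omega)
    have hb5 := hb (m + 5) (by omega)
    -- The two previous ratios replace `r (m + 2)` and `r (m + 3)`; the combination `P (m + 3) * h1
    -- - P (m + 1) * h3` of the recurrences eliminates `θ`.
    have key : r (m + 4) * P (m + 4) * c (m + 3) * c (m + 4) =
        P (m + 2) * b (m + 4) * b (m + 5) := by
      apply mul_left_cancel₀ (mul_ne_zero hb3 hPm1)
      linear_combination (P (m + 2) * P (m + 3) * c (m + 2) * c (m + 3)) * h2 +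
        b (m + 5) * P (m + 2) * e3 - r (m + 4) * c (m + 3) * P (m + 3) * e2 +
        r (m + 4) * c (m + 3) * P (m + 2) * e3 +
        r (m + 4) * c (m + 3) * b (m + 3) * P (m + 3) * h1 -
        r (m + 4) * c (m + 3) * b (m + 3) * P (m + 1) * h3
    refine ⟨hPm2, fun h0 => ?_, key⟩
    rw [h0] at key
    simp only [mul_zero, zero_mul] at key
    exact mul_ne_zero (mul_ne_zero hPm2 hb4) hb5 key.symm

/-! ### Thin irreducible modules: bases, vanishing of `E_j v`, and the transition formula. -/

section Modules

open scoped Matrix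

variable {X : Type*} [Fintype X] {Γ : SimpleGraph X} {x : X}

theorem tilde_eq {θ : ℝ} (hθ : θ ^ 2 ≠ b Γ 2) :
    (1 + tilde Γ θ) * (θ ^ 2 - b Γ 2) = -(b Γ 2 * b Γ 3) := by
  have := sub_ne_zero.2 hθ
  rw [tilde]
  field_simp
  ring

variable [DecidableEq X]

theorem exists_smul_eq_of_isThin {W : Submodule ℂ (X → ℂ)} (hthin : IsThin Γ x W) {m : ℕ}
    (hm : m ≤ Γ.diam) {u w : X → ℂ} (hu : u ∈ W) (hw : w ∈ W) (hus : SupportedAt Γ x m u)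
    (hws : SupportedAt Γ x m w) (hu0 : u ≠ 0) : ∃ ρ : ℂ, w = ρ • u := by
  have key : ∀ y, y ∈ W → SupportedAt Γ x m y → y ∈ dualPart Γ x m W := fun y hy hys =>
    ⟨y, hy, hys.dualIdem_self⟩
  obtain ⟨y, hy⟩ := finrank_le_one_iff.1 (hthin m hm)
  obtain ⟨a, ha⟩ := hy ⟨u, key u hu hus⟩
  obtain ⟨e, he⟩ := hy ⟨w, key w hw hws⟩
  have ha' : a • (y : X → ℂ) = u := congrArg Subtype.val ha
  have he' : e • (y : X → ℂ) = w := congrArg Subtype.val he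
  have ha0 : a ≠ 0 := by
    rintro rfl
    rw [zero_smul] at ha'
    exact hu0 ha'.symm
  refine ⟨e / a, ?_⟩
  rw [← ha', ← he', smul_smul, div_mul_cancel₀ _ ha0]

namespace IsEndpointTwoVector

variable {W : Submodule ℂ (X → ℂ)} {v : X → ℂ}

/-- The raised part is given by `raise_up`; the lowered part lies in a sphere component of dimension
at most one, spanned by `up_{i-1}`. For `i = 0` it lies in `E*_1 W = 0`, so `ρ = 0` and the
truncated index is immaterial. -/
theorem adj_up (h : IsEndpointTwoVector Γ x W v) (hthin : IsThin Γ x W) {i : ℕ}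
    (hi : i + 1 ≤ Γ.diam) (h0 : up Γ x v (i - 1) ≠ 0) :
    ∃ ρ : ℂ, distMatrix Γ 1 *ᵥ up Γ x v i =
      (c Γ (i + 1) : ℂ) • up Γ x v (i + 1) + ρ • up Γ x v (i - 1) := by
  have h1 := (supportedAt_up (x := x) (Γ := Γ) v i).adj_eq h.distanceRegular h.bipartite
  rw [show i + 1 + 2 = i + 3 from rfl, h.raise_up hi] at h1
  have hmem := h.isTModule.dualIdem_mem (i + 1) (h.isTModule.adj_mem (h.up_mem i))
  have hsupp := supportedAt_dualIdem (Γ := Γ) (x := x) (i + 1) (distMatrix Γ 1 *ᵥ up Γ x v i)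
  rcases i with _ | i
  · refine ⟨0, ?_⟩
    rw [h1, zero_smul]
    congr 1
    ext z
    by_cases hz : Γ.dist x z = 0 + 1
    · exact h.eq_zero_of_lt _ hmem z (by omega)
    · exact hsupp z hz
  · obtain ⟨ρ, hρ⟩ := exists_smul_eq_of_isThin hthin (by omega) (h.up_mem i) hmem
      (supportedAt_up v i) hsupp h0
    exact ⟨ρ, by rw [h1, hρ]; rfl⟩

theorem up_eq_zero_of_diam_lt (h : IsEndpointTwoVector Γ x W v) {i : ℕ} (hi : Γ.diam < i + 2) :
    up Γ x v i = 0 := by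
  ext z
  refine supportedAt_up v i z ?_
  have := dist_le_diam h.distanceRegular.1 x z
  omega

/-- The nonzero ones among the vectors `E*_{i+2} A_i v` are an initial segment and span `W`. -/
theorem exists_span_up (h : IsEndpointTwoVector Γ x W v) (hW : IsIrreducibleTModule Γ x W)
    (hthin : IsThin Γ x W) : ∃ N, 0 < N ∧ N + 1 ≤ Γ.diam ∧ (∀ i < N, up Γ x v i ≠ 0) ∧
      Submodule.span ℂ (up Γ x v '' {i | i < N}) = W := by
  have hex : ∃ i, up Γ x v i = 0 := ⟨Γ.diam, h.up_eq_zero_of_diam_lt (by omega)⟩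
  classical
  have hD := h.four_le_diam
  obtain ⟨N, hN, hNmin⟩ : ∃ N, up Γ x v N = 0 ∧ ∀ i < N, up Γ x v i ≠ 0 :=
    ⟨Nat.find hex, Nat.find_spec hex, fun i hi => Nat.find_min hex hi⟩
  have hpos : 0 < N := by
    rcases Nat.eq_zero_or_pos N with rfl | h0
    · rw [h.up_zero] at hN
      exact absurd hN h.ne_zero
    · exact h0
  have hle : N + 1 ≤ Γ.diam := by
    by_contra hlt
    exact hNmin (Γ.diam - 1) (by omega) (h.up_eq_zero_of_diam_lt (by omega))
  refine ⟨N, hpos, hle, hNmin, ?_⟩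
  set S := Submodule.span ℂ (up Γ x v '' {i | i < N}) with hS
  have hin : ∀ i ≤ N, up Γ x v i ∈ S := by
    intro i hi
    rcases hi.eq_or_lt with rfl | hi
    · rw [hN]
      exact S.zero_mem
    · exact Submodule.subset_span ⟨i, hi, rfl⟩
  have hclosed : ∀ B : Matrix X X ℂ, (∀ i < N, B *ᵥ up Γ x v i ∈ S) → ∀ w ∈ S, B *ᵥ w ∈ S := by
    intro B hB
    have : S ≤ S.comap B.mulVecLin := by
      rw [hS, Submodule.span_le]
      rintro _ ⟨i, hi, rfl⟩
      exact hB i hi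
    exact fun w hw => this hw
  -- Both kinds of generators of `T` send each `up_i` with `i < N` into the span; at the top, `A`
  -- can only produce `up_N = 0` or go down.
  have hT : IsTModule Γ x S := by
    refine isTModule_of (hclosed _ fun i hi => ?_) fun j => hclosed _ fun i hi => ?_
    · obtain ⟨ρ, hρ⟩ := h.adj_up hthin (i := i) (by omega) (hNmin _ (by omega))
      rw [hρ]
      exact S.add_mem (S.smul_mem _ (hin _ hi)) (S.smul_mem _ (hin _ (by omega)))
    · by_cases hj : j = i + 2
      · rw [hj, (supportedAt_up v i).dualIdem_self]
        exact hin i hi.le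
      · rw [(supportedAt_up v i).dualIdem_of_ne hj]
        exact S.zero_mem
  have hle : S ≤ W := by
    rw [hS, Submodule.span_le]
    rintro _ ⟨i, -, rfl⟩
    exact h.up_mem i
  refine (hW.2.2 S hT hle).resolve_left fun hbot => hNmin 0 hpos ?_
  have := hin 0 (Nat.zero_le _)
  rwa [hbot, Submodule.mem_bot] at this

/-- As `c_{i+1} ≠ 0`, `adj_up` can be solved for `up_{i+1}`, so every `up_i` arises from `v` by
applying `A`. -/
theorem le_of_adj_invariant (h : IsEndpointTwoVector Γ x W v) (hW : IsIrreducibleTModule Γ x W)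
    (hthin : IsThin Γ x W) {U : Submodule ℂ (X → ℂ)} (hU : ∀ w ∈ U, distMatrix Γ 1 *ᵥ w ∈ U)
    (hv : v ∈ U) : W ≤ U := by
  obtain ⟨N, hN0, hND, hN, hspan⟩ := h.exists_span_up hW hthin
  have hmem : ∀ i < N, up Γ x v i ∈ U := by
    intro i
    induction i using Nat.strong_induction_on with
    | _ i ih =>
      intro hi
      rcases i with _ | i
      · rwa [h.up_zero]
      · obtain ⟨ρ, hρ⟩ := h.adj_up hthin (i := i) (by omega) (hN _ (by omega))
        have hc : (c Γ (i + 1) : ℂ) ≠ 0 :=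
          Complex.ofReal_ne_zero.2 (c_pos h.distanceRegular (by omega) (by omega)).ne'
        rw [← U.smul_mem_iff hc, eq_sub_iff_add_eq.2 hρ.symm]
        exact U.sub_mem (hU _ (ih i (by omega) (by omega)))
          (U.smul_mem _ (ih (i - 1) (by omega) (by omega)))
  rw [← hspan, Submodule.span_le]
  rintro _ ⟨i, hi, rfl⟩
  exact hmem i hi

/-- On the second sphere, `A_0 v`, `A_2 v` and `A_4 v` are `v`, `η v` and, by `middle`, `-(1 + η)
v`. -/
theorem star_dotProduct_eigenProj (h : IsEndpointTwoVector Γ x W v) {η t : ℝ}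
    (hη : ∀ z, Γ.dist x z = 2 → (distMatrix Γ 2 *ᵥ v) z = η * v z) {F : ℕ → ℂ}
    (hF : ∀ y z, eigenProj Γ t y z = F (Γ.dist y z)) :
    star v ⬝ᵥ (eigenProj Γ t *ᵥ v) = (F 0 + η * F 2 - (1 + η) * F 4) * (star v ⬝ᵥ v) := by
  rw [dotProduct, dotProduct, Finset.mul_sum]
  refine Finset.sum_congr rfl fun z _ => ?_
  by_cases hz : Γ.dist x z = 2
  · have e1 := h.sum_dist F (i := 0) hz
    have e2 := h.middle (i := 0) hz
    rw [distMatrix_zero h.distanceRegular, Matrix.one_mulVec] at e1 e2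
    simp only [zero_add] at e1 e2
    rw [hη z hz] at e1 e2
    have e3 : (eigenProj Γ t *ᵥ v) z = ∑ y, F (Γ.dist z y) * v y := by
      simp only [Matrix.mulVec, dotProduct, hF]
    rw [e3, e1]
    linear_combination star v z * F 4 * e2
  · simp [h.supported z hz]

open scoped ComplexOrder in
/-- The vanishing of `E v` for a primitive idempotent `E`. -/
theorem eigenProj_mulVec_eq_zero_iff (h : IsEndpointTwoVector Γ x W v) {η t : ℝ}
    (hη : ∀ z, Γ.dist x z = 2 → (distMatrix Γ 2 *ᵥ v) z = η * v z) (ht : t ∈ spec Γ) :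
    eigenProj Γ t *ᵥ v = 0 ↔
      (b Γ 0 ^ 2 - t ^ 2) * (b Γ 2 * b Γ 3 + (1 + η) * (t ^ 2 - b Γ 2)) = 0 := by
  have hD := h.four_le_diam
  have hΓ := h.distanceRegular
  have hb := h.bipartite
  obtain ⟨F, hF0, hF, hrec⟩ := exists_eigenProj_eq hΓ hb ht
  have hvv : star v ⬝ᵥ v ≠ 0 := by
    rw [Ne, dotProduct_star_self_eq_zero]
    exact h.ne_zero
  rw [DRG.eigenProj_mulVec_eq_zero_iff, h.star_dotProduct_eigenProj hη hF, mul_eq_zero,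
    or_iff_left hvv]
  have r0 := hrec 0 (by omega)
  have r1 := hrec 1 (by omega)
  have r2 := hrec 2 (by omega)
  have r3 := hrec 3 (by omega)
  simp only [c_zero, c_one hΓ (by omega : 1 ≤ Γ.diam), zero_add, Nat.reduceAdd, Nat.reduceSub,
    Complex.ofReal_zero, Complex.ofReal_one, zero_mul, one_mul] at r0 r1 r2 r3
  have c1 := b_add_c hΓ hb (i := 1) (by omega)
  rw [c_one hΓ (by omega)] at c1
  have e1 : b Γ 1 = b Γ 0 - 1 := by linarith
  have e2 : c Γ 2 = b Γ 0 - b Γ 2 := by linarith [b_add_c hΓ hb (i := 2) (by omega)]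
  have e3 : c Γ 3 = b Γ 0 - b Γ 3 := by linarith [b_add_c hΓ hb (i := 3) (by omega)]
  have p0 := (b_pos hΓ (i := 0) (by omega)).ne'
  have p1 := (b_pos hΓ (i := 1) (by omega)).ne'
  have p2 := (b_pos hΓ (i := 2) (by omega)).ne'
  have p3 := (b_pos hΓ (i := 3) (by omega)).ne'
  have hne : ((b Γ 0 * b Γ 1 * b Γ 2 * b Γ 3 : ℝ) : ℂ) ≠ 0 :=
    Complex.ofReal_ne_zero.2 (by positivity)
  -- The recurrence expresses `F 2` and `F 4` through `F 0`; the product of the `b_i` clears its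
  -- denominators.
  have key : ((b Γ 0 * b Γ 1 * b Γ 2 * b Γ 3 : ℝ) : ℂ) * (F 0 + η * F 2 - (1 + η) * F 4) =
      F 0 * (((b Γ 0 ^ 2 - t ^ 2) * (b Γ 2 * b Γ 3 + (1 + η) * (t ^ 2 - b Γ 2)) : ℝ) : ℂ) := by
    rw [e2] at r2
    rw [e3] at r3
    rw [e1] at r1 ⊢
    push_cast at r1 r2 r3 ⊢
    linear_combination (-(1 + η) * b Γ 0 * (b Γ 0 - 1) * b Γ 2 : ℂ) * r3 -
      ((1 + η) * b Γ 0 * (b Γ 0 - 1) * t : ℂ) * r2 +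
      (η * b Γ 0 * b Γ 2 * b Γ 3 - (1 + η) * b Γ 0 * (t ^ 2 - b Γ 2 * (b Γ 0 - b Γ 3)) : ℂ) * r1 +
      ((η * b Γ 2 * b Γ 3 - (1 + η) * (t ^ 2 - b Γ 2 * (b Γ 0 - b Γ 3))) * t +
        (1 + η) * (b Γ 0 - 1) * t * (b Γ 0 - b Γ 2) : ℂ) * r0
  constructor
  · intro hz
    rw [hz, mul_zero] at key
    exact Complex.ofReal_eq_zero.1 ((mul_eq_zero.1 key.symm).resolve_left hF0)
  · intro hz
    rw [hz, Complex.ofReal_zero, mul_zero] at key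
    exact (mul_eq_zero.1 key).resolve_left hne

end IsEndpointTwoVector

namespace IsEndpointTwoVector

variable {W : Submodule ℂ (X → ℂ)} {v : X → ℂ}

/-- By `tilde_eq` the second factor of the criterion becomes `(1 + η)(t² - θ²)`, and `1 + η ≠ 0`
because `b_2 b_3 ≠ 0`. -/
theorem eigenProj_tilde (h : IsEndpointTwoVector Γ x W v) {θ t : ℝ} (hθ : θ ^ 2 ≠ b Γ 2)
    (hη : ∀ z, Γ.dist x z = 2 → (distMatrix Γ 2 *ᵥ v) z = tilde Γ θ * v z) (ht : t ∈ spec Γ) :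
    eigenProj Γ t *ᵥ v = 0 ↔ t ^ 2 = b Γ 0 ^ 2 ∨ t ^ 2 = θ ^ 2 := by
  have hD := h.four_le_diam
  have h1 := tilde_eq hθ
  have p2 := (b_pos h.distanceRegular (i := 2) (by omega)).ne'
  have p3 := (b_pos h.distanceRegular (i := 3) (by omega)).ne'
  have hne : 1 + tilde Γ θ ≠ 0 := by
    intro h0
    rw [h0, zero_mul] at h1
    exact mul_ne_zero p2 p3 (neg_eq_zero.1 h1.symm)
  rw [h.eigenProj_mulVec_eq_zero_iff hη ht, mul_eq_zero]
  refine or_congr ⟨fun h => by linarith, fun h => by linarith⟩ ⟨fun h2 => ?_, fun h2 => ?_⟩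
  · apply mul_left_cancel₀ hne
    linarith
  · rw [h2, h1]
    ring

theorem span_primIdem (h : IsEndpointTwoVector Γ x W v) (hW : IsIrreducibleTModule Γ x W)
    (hthin : IsThin Γ x W) {J : Finset ℕ} (hJ : ∀ j ∈ J, j ≤ Γ.diam)
    (h0 : ∀ j ≤ Γ.diam, j ∉ J → primIdem Γ j *ᵥ v = 0) :
    Submodule.span ℂ (Set.range fun j : {j : ℕ // j ∈ J} => primIdem Γ j *ᵥ v) = W := by
  have hD := h.four_le_diam
  have hΓ := h.distanceRegular
  have hb := h.bipartite
  apply le_antisymm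
  · rw [Submodule.span_le]
    rintro _ ⟨⟨j, hj⟩, rfl⟩
    obtain ⟨q, hq⟩ := exists_aeval_eq_eigenProj
      (eigenvalue_mem_spec hΓ hb (by omega) (hJ j hj))
    change primIdem Γ j *ᵥ v ∈ W
    rw [primIdem_eq, ← hq]
    exact aeval_mulVec_mem (fun _ hw => h.isTModule.adj_mem hw) q h.mem
  · set U := Submodule.span ℂ (Set.range fun j : {j : ℕ // j ∈ J} => primIdem Γ j *ᵥ v) with hU
    refine h.le_of_adj_invariant hW hthin (U := U) ?_ ?_
    · have : U ≤ U.comap (distMatrix Γ 1).mulVecLin := by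
        rw [hU, Submodule.span_le]
        rintro _ ⟨j, rfl⟩
        rw [SetLike.mem_coe, Submodule.mem_comap, Matrix.mulVecLin_apply]
        beta_reduce
        rw [primIdem_eq, adj_mulVec_eigenProj]
        exact Submodule.smul_mem _ _ (Submodule.subset_span ⟨j, rfl⟩)
      exact fun w hw => this hw
    · have h1 : v = ∑ j ∈ Finset.range (Γ.diam + 1), primIdem Γ j *ᵥ v := by
        rw [← Matrix.sum_mulVec]
        simp only [primIdem_eq]
        rw [← sum_spec hΓ hb (by omega) (eigenProj Γ), sum_eigenProj, Matrix.one_mulVec]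
      suffices ∑ j ∈ Finset.range (Γ.diam + 1), primIdem Γ j *ᵥ v ∈ U by rwa [← h1] at this
      refine Submodule.sum_mem U fun j hj => ?_
      rw [Finset.mem_range] at hj
      by_cases hjJ : j ∈ J
      · exact Submodule.subset_span ⟨⟨j, hjJ⟩, rfl⟩
      · rw [h0 j (by omega) hjJ]
        exact U.zero_mem

theorem linearIndependent_primIdem (h : IsEndpointTwoVector Γ x W v)
    {J : Finset ℕ} (hJ : ∀ j ∈ J, j ≤ Γ.diam) (h0 : ∀ j ∈ J, primIdem Γ j *ᵥ v ≠ 0) :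
    LinearIndependent ℂ fun j : {j : ℕ // j ∈ J} => primIdem Γ j *ᵥ v := by
  have hD := h.four_le_diam
  have hinj : Function.Injective fun j : {j : ℕ // j ∈ J} => (eigenvalue Γ j : ℂ) := by
    intro i j hij
    have hij' : eigenvalue Γ i = eigenvalue Γ j := Complex.ofReal_injective hij
    rcases lt_trichotomy (i : ℕ) j with h1 | h1 | h1
    · exact absurd hij' (eigenvalue_lt h.distanceRegular h.bipartite (by omega) h1 (hJ _ j.2)).ne'
    · exact Subtype.ext h1
    · exact absurd hij' (eigenvalue_lt h.distanceRegular h.bipartite (by omega) h1 (hJ _ i.2)).ne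
  refine Module.End.eigenvectors_linearIndependent' (distMatrix Γ 1).mulVecLin _ hinj _
    fun j => ⟨?_, h0 j j.2⟩
  rw [Module.End.mem_eigenspace_iff, Matrix.mulVecLin_apply, primIdem_eq, adj_mulVec_eigenProj]

theorem aeval_mulVec_eq_sum (h : IsEndpointTwoVector Γ x W v)
    {J : Finset ℕ} (hJ : ∀ j ∈ J, j ≤ Γ.diam)
    (h0 : ∀ j ≤ Γ.diam, j ∉ J → primIdem Γ j *ᵥ v = 0) (q : ℝ[X]) :
    aeval (distMatrix Γ 1) q *ᵥ v =
      ∑ j ∈ J, ((q.eval (eigenvalue Γ j) : ℝ) : ℂ) • primIdem Γ j *ᵥ v := by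
  have hD := h.four_le_diam
  rw [aeval_eq_sum, Matrix.sum_mulVec, sum_spec h.distanceRegular h.bipartite (by omega)
    (fun t => (q.eval t • eigenProj Γ t) *ᵥ v)]
  have hsub : J ⊆ Finset.range (Γ.diam + 1) := fun j hj =>
    Finset.mem_range.2 (Nat.lt_succ_of_le (hJ j hj))
  rw [← Finset.sum_subset hsub]
  · refine Finset.sum_congr rfl fun j _ => ?_
    rw [Matrix.smul_mulVec, primIdem_eq]
    rfl
  · intro j hj hjJ
    rw [Finset.mem_range] at hj
    rw [Matrix.smul_mulVec, ← primIdem_eq, h0 j (by omega) hjJ, smul_zero]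

/-- In a thin module, `E*_{i+2} A_i v` is a polynomial in the adjacency matrix applied to `v`. -/
theorem aeval_g (h : IsEndpointTwoVector Γ x W v) (hthin : IsThin Γ x W) {θ : ℝ}
    (hθ0 : θ ≠ 0) (hθ : θ ^ 2 ≠ b Γ 2)
    (hη : ∀ z, Γ.dist x z = 2 → (distMatrix Γ 2 *ᵥ v) z = tilde Γ θ * v z)
    (hup : ∀ i, i + 4 ≤ Γ.diam → up Γ x v i ≠ 0) {i : ℕ} (hi : i + 4 ≤ Γ.diam) :
    aeval (distMatrix Γ 1) (g Γ θ i) *ᵥ v = up Γ x v i := by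
  have hD := h.four_le_diam
  have hΓ := h.distanceRegular
  have hb := h.bipartite
  have hex : ∀ m, ∃ ρ : ℂ, m + 4 ≤ Γ.diam → lo Γ x v (m + 2) = ρ • up Γ x v m := by
    intro m
    by_cases hm : m + 4 ≤ Γ.diam
    · obtain ⟨ρ, hρ⟩ := exists_smul_eq_of_isThin hthin (m := m + 2) (by omega) (h.up_mem m)
        (h.lo_mem (m + 2)) (supportedAt_up v m) (supportedAt_lo v (m + 2)) (hup m hm)
      exact ⟨ρ, fun _ => hρ⟩
    · exact ⟨0, fun h => absurd h hm⟩
  choose ρ hρ using hex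
  have hP : ∀ i, i + 2 ≤ Γ.diam → θ * (p Γ (i + 1)).eval θ =
      c Γ (i + 2) * (p Γ (i + 2)).eval θ + b Γ (i + 2) * (p Γ i).eval θ := by
    intro i hi
    have := congrArg (Polynomial.eval θ) (X_mul_p hΓ hb hi)
    simpa using this
  have hP1 : (p Γ 1).eval θ = θ := by
    rw [p_one, f_one hΓ (by omega), eval_X]
  have hP2 : c Γ 2 * (p Γ 2).eval θ = θ ^ 2 - b Γ 2 := by
    have := hP 0 (by omega)
    simp only [zero_add, hP1, p_zero, eval_one] at this
    linarith
  have hP2ne : (p Γ 2).eval θ ≠ 0 := by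
    intro h0
    rw [h0, mul_zero] at hP2
    exact sub_ne_zero.2 hθ hP2.symm
  -- Initial value: `lo_2` is `A_4 v` on the second sphere, so `ρ 0 = -(1 + η)`, while `c_2 p_2(θ) =
  -- θ² - b_2`.
  have hr2 : ρ 0 * (p Γ 2).eval θ * c Γ 2 = b Γ 2 * b Γ 3 := by
    have h1 := hρ 0 hD
    obtain ⟨z, hz⟩ := Function.ne_iff.1 (hup 0 hD)
    rw [Pi.zero_apply] at hz
    have hz2 : Γ.dist x z = 0 + 2 := by
      by_contra hne
      exact hz (supportedAt_up v 0 z hne)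
    have h2 := h.middle hz2
    have h3 := congrFun h1 z
    rw [lo, ← Matrix.mulVec_mulVec, dualIdem_mulVec_apply, if_pos hz2, Pi.smul_apply,
      smul_eq_mul, h.up_zero] at h3
    rw [h.up_zero] at hz
    rw [distMatrix_zero hΓ, Matrix.one_mulVec] at h2
    simp only [zero_add, Nat.reduceAdd] at h2 h3
    rw [hη z hz2, h3] at h2
    have h4 : ρ 0 = -(1 + tilde Γ θ) := by
      apply mul_right_cancel₀ hz
      linear_combination h2
    have h5 : (1 + (tilde Γ θ : ℂ)) * (θ ^ 2 - b Γ 2) = -(b Γ 2 * b Γ 3) := by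
      exact_mod_cast tilde_eq hθ
    have h6 : (c Γ 2 : ℂ) * ((p Γ 2).eval θ : ℝ) = θ ^ 2 - b Γ 2 := by exact_mod_cast hP2
    rw [h4]
    linear_combination -(1 + (tilde Γ θ : ℂ)) * h6 - h5
  -- Compute `E*_{m+2} A lo_{m+3}` by `lower_lo`, and again by `lower_up` after writing `lo_{m+3} =
  -- ρ (m + 1) • up_{m+1}`; then compare coefficients of `up_m ≠ 0`. For `m = 0` the truncated `ρ (m
  -- - 1)` is multiplied by `c_0 = 0`.
  have hrec : ∀ m, m + 5 ≤ Γ.diam → ρ (m + 1) * (ρ (m - 1) * c Γ m + b Γ (m + 2) -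
      c Γ (m + 2) * ρ m) = b Γ (m + 4) * ρ m := by
    intro m hm
    have e1 := h.lower_lo (i := m + 2) (by omega)
    have e2 := h.lower_up (i := m) (by omega)
    rw [hρ (m + 1) (by omega), Matrix.mulVec_smul, Matrix.mulVec_smul, e2, hρ m (by omega)] at e1
    have e3 : dualIdem Γ x (m + 2) *ᵥ (distMatrix Γ 1 *ᵥ lo Γ x v (m + 1)) =
        (ρ (m - 1) * c Γ m) • up Γ x v m := by
      rcases m with _ | m
      · rw [h.lo_of_lt (i := 0 + 1) one_lt_two, c_zero]
        simp
      · rw [hρ m (by omega), Matrix.mulVec_smul, Matrix.mulVec_smul,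
          show m + 1 + 2 = m + 3 from rfl, h.raise_up (by omega), smul_smul]
        rfl
    rw [e3, smul_smul, smul_smul, ← add_smul, ← sub_smul, smul_smul] at e1
    exact smul_left_injective ℂ (hup m (by omega)) e1
  -- The shift `r j = ρ (j - 2)` indexes the ratio by the subscript of `lo`.
  have hratio := ratio_recurrence (K := ℂ) (D := Γ.diam) (c := fun i => (c Γ i : ℂ))
    (b := fun i => (b Γ i : ℂ)) (P := fun i => ((p Γ i).eval θ : ℝ)) (r := fun j => ρ (j - 2))
    (θ := θ) (fun i hi => Complex.ofReal_ne_zero.2 (b_pos hΓ hi).ne') (by simp [c_zero])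
    (by simp [c_one hΓ (by omega : 1 ≤ Γ.diam)]) (by simp [p_zero]) (by simp [hP1])
    (Complex.ofReal_ne_zero.2 hθ0) (Complex.ofReal_ne_zero.2 hP2ne)
    (fun i hi => by exact_mod_cast hP i hi) hr2 hrec
  induction i using Nat.twoStepInduction with
  | zero => rw [g_zero hΓ (by omega), map_one, Matrix.one_mulVec, h.up_zero]
  | one => rw [g_one hΓ (by omega) hθ0, h.aeval_p (by omega), h.lo_of_lt one_lt_two, sub_zero]
  | more i ih _ =>
    obtain ⟨q1, q2, q3⟩ := hratio i (by omega)
    have q1' := Complex.ofReal_ne_zero.1 q1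
    have q2' := Complex.ofReal_ne_zero.1 q2
    have hc1 : (c Γ (i + 1) : ℂ) ≠ 0 :=
      Complex.ofReal_ne_zero.2 (c_pos hΓ (by omega) (by omega)).ne'
    have hc2 : (c Γ (i + 2) : ℂ) ≠ 0 :=
      Complex.ofReal_ne_zero.2 (c_pos hΓ (by omega) (by omega)).ne'
    have hρi : ρ i = (((p Γ i).eval θ * b Γ (i + 2) * b Γ (i + 3) /
        ((p Γ (i + 2)).eval θ * c Γ (i + 1) * c Γ (i + 2)) : ℝ) : ℂ) := by
      push_cast
      rw [eq_div_iff (mul_ne_zero (mul_ne_zero q2 hc1) hc2), ← q3]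
      simp only [Nat.add_sub_cancel]
      ring
    -- Both sides satisfy one recursion, as `up_{i+2} = p_{i+2}(A) v + lo_{i+2}` and `lo_{i+2} = ρ i
    -- • up_i`.
    rw [g_add_two hΓ (by omega) q1' q2', map_add, map_mul, aeval_C, Matrix.add_mulVec,
      h.aeval_p (by omega), ← Algebra.smul_def, Matrix.smul_mulVec, ih (by omega),
      hρ i (by omega), hρi]
    exact sub_add_cancel _ _

end IsEndpointTwoVector

theorem card_indexSet {D n : ℕ} (h1 : 1 ≤ n) (h2 : n + 1 ≤ D) (h3 : n ≠ D - n) :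
    (indexSet D n).card = D - 3 := by
  have : indexSet D n = ((Finset.Icc 1 (D - 1)).erase n).erase (D - n) := by
    ext j
    simp only [indexSet, Finset.mem_filter, Finset.mem_erase, Finset.mem_Icc]
    tauto
  rw [this, Finset.card_erase_of_mem, Finset.card_erase_of_mem, Nat.card_Icc]
  · omega
  · rw [Finset.mem_Icc]; omega
  · rw [Finset.mem_erase, Finset.mem_Icc]; omega

theorem isEndpointTwoVector_of (hΓ : IsDistanceRegular Γ) (hb : Γ.IsBipartite)
    (hD : 4 ≤ Γ.diam) {W : Submodule ℂ (X → ℂ)} (hW : IsTModule Γ x W) (hend : endpoint Γ x W = 2)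
    {v : X → ℂ} (hv : v ∈ dualPart Γ x 2 W) (hv0 : v ≠ 0) : IsEndpointTwoVector Γ x W v := by
  obtain ⟨w, hw, hwv⟩ := hv
  have hwv' : dualIdem Γ x 2 *ᵥ w = v := hwv
  refine ⟨hΓ, hb, hD, hW, ?_, hwv' ▸ hW.dualIdem_mem 2 hw, hwv' ▸ supportedAt_dualIdem 2 w, hv0⟩
  intro w hw z hz
  have hbot : dualPart Γ x (Γ.dist x z) W = ⊥ := by
    by_contra hne
    have : endpoint Γ x W ≤ Γ.dist x z := Nat.sInf_le ⟨dist_le_diam hΓ.1 x z, hne⟩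
    omega
  have hmem : dualIdem Γ x (Γ.dist x z) *ᵥ w ∈ dualPart Γ x (Γ.dist x z) W := ⟨w, hw, rfl⟩
  rw [hbot, Submodule.mem_bot] at hmem
  have := congrFun hmem z
  rwa [dualIdem_mulVec_apply, if_pos rfl] at this

theorem HasLocalEigenvalue.apply {W : Submodule ℂ (X → ℂ)} {η : ℝ}
    (h : HasLocalEigenvalue Γ x W η) {v : X → ℂ} (hv : v ∈ dualPart Γ x 2 W)
    (hs : SupportedAt Γ x 2 v) (z : X) (hz : Γ.dist x z = 2) :
    (distMatrix Γ 2 *ᵥ v) z = η * v z := by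
  have h1 := congrFun (h.2 v hv) z
  rwa [← Matrix.mulVec_mulVec, hs.dualIdem_self, ← Matrix.mulVec_mulVec, dualIdem_mulVec_apply,
    if_pos hz] at h1

end Modules

end DRG

theorem mainTheorem10 {X : Type*} [Fintype X] [DecidableEq X] (Γ : SimpleGraph X)
    (hΓ : DRG.IsDistanceRegular Γ) (hbip : Γ.IsBipartite)
    (D : ℕ) (hdiam : Γ.diam = D) (hD : 4 ≤ D) (hk : 3 ≤ DRG.b Γ 0) (x : X)
    (n : ℕ) (hn : n = 1 ∨ (Odd D ∧ n = D / 2))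
    (W : Submodule ℂ (X → ℂ)) (hW : DRG.IsIrreducibleTModule Γ x W)
    (hthin : DRG.IsThin Γ x W) (hend : DRG.endpoint Γ x W = 2)
    (hloc : DRG.HasLocalEigenvalue Γ x W (DRG.tilde Γ (DRG.eigenvalue Γ n)))
    (v : X → ℂ) (hv : v ∈ DRG.dualPart Γ x 2 W) (hv0 : v ≠ 0) :
    -- the vectors `E_j v` (`1 ≤ j ≤ D - 1`, `j ≠ n`, `j ≠ D - n`) form a basis of `W`
    (LinearIndependent ℂ
        (fun j : {j : ℕ // j ∈ DRG.indexSet D n} => (DRG.primIdem Γ j).mulVec v) ∧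
      Submodule.span ℂ (Set.range
        (fun j : {j : ℕ // j ∈ DRG.indexSet D n} => (DRG.primIdem Γ j).mulVec v)) = W) ∧
    -- the vectors `E*_{i+2} A_i v` (`0 ≤ i ≤ D - 4`) form a basis of `W`
    (LinearIndependent ℂ
        (fun i : {i : ℕ // i + 4 ≤ D} =>
          (DRG.dualIdem Γ x (i + 2) * DRG.distMatrix Γ i).mulVec v) ∧
      Submodule.span ℂ (Set.range
        (fun i : {i : ℕ // i + 4 ≤ D} =>
          (DRG.dualIdem Γ x (i + 2) * DRG.distMatrix Γ i).mulVec v)) = W) ∧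
    -- the transition matrix between them
    (∀ i : ℕ, i + 4 ≤ D →
      (DRG.dualIdem Γ x (i + 2) * DRG.distMatrix Γ i).mulVec v =
        ∑ j ∈ DRG.indexSet D n,
          (((DRG.g Γ (DRG.eigenvalue Γ n) i).eval (DRG.eigenvalue Γ j) : ℝ) : ℂ) •
            (DRG.primIdem Γ j).mulVec v) := by
  subst hdiam
  have h := DRG.isEndpointTwoVector_of hΓ hbip hD hW.1 hend hv hv0
  have hη := hloc.apply hv h.supported
  have hD1 : 1 ≤ Γ.diam := by omega
  -- The strict inequality gives both `θ_n > 0` and `n ≠ D - n`, so exactly `D - 3` indices survive.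
  have hn2 : 1 ≤ n ∧ 2 * n < Γ.diam := by
    rcases hn with rfl | ⟨⟨d, hd⟩, rfl⟩ <;> omega
  have hθ := DRG.eigenvalue_sq_ne hΓ hbip hD hn
  have hθ0 := DRG.eigenvalue_pos hΓ hbip hn2.2
  have hJ : ∀ j ∈ DRG.indexSet Γ.diam n, 1 ≤ j ∧ j + 1 ≤ Γ.diam ∧ j ≠ n ∧ j ≠ Γ.diam - n := by
    intro j hj
    rw [DRG.indexSet, Finset.mem_filter, Finset.mem_Icc] at hj
    omega
  have hJle : ∀ j ∈ DRG.indexSet Γ.diam n, j ≤ Γ.diam := fun j hj => by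
    have := hJ j hj
    omega
  have hzero : ∀ j ≤ Γ.diam, j ∉ DRG.indexSet Γ.diam n → (DRG.primIdem Γ j).mulVec v = 0 := by
    intro j hj hjJ
    rw [DRG.primIdem_eq,
      h.eigenProj_tilde hθ hη (DRG.eigenvalue_mem_spec hΓ hbip hD1 hj)]
    have hcases : j = 0 ∨ j = Γ.diam - 0 ∨ j = n ∨ j = Γ.diam - n := by
      rw [DRG.indexSet, Finset.mem_filter, Finset.mem_Icc] at hjJ
      omega
    rcases hcases with rfl | rfl | rfl | rfl
    · rw [DRG.eigenvalue_zero hΓ hbip hD1]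
      exact Or.inl rfl
    · rw [DRG.eigenvalue_sub hΓ hbip hD1 (by omega), DRG.eigenvalue_zero hΓ hbip hD1, neg_sq]
      exact Or.inl rfl
    · exact Or.inr rfl
    · rw [DRG.eigenvalue_sub hΓ hbip hD1 (by omega), neg_sq]
      exact Or.inr rfl
  have hne : ∀ j ∈ DRG.indexSet Γ.diam n, (DRG.primIdem Γ j).mulVec v ≠ 0 := by
    intro j hj
    obtain ⟨h1, h2, h3, h4⟩ := hJ j hj
    have hjm := DRG.eigenvalue_mem_spec hΓ hbip hD1 (hJle j hj)
    rw [DRG.primIdem_eq, Ne, h.eigenProj_tilde hθ hη hjm]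
    rintro (h5 | h5)
    · exact (DRG.eigenvalue_sq_lt hΓ hbip h1 h2).ne h5
    · have hinj : ∀ i ≤ Γ.diam, DRG.eigenvalue Γ j = DRG.eigenvalue Γ i → j = i := by
        intro i hi hij
        rcases lt_trichotomy j i with h6 | h6 | h6
        · exact absurd hij (DRG.eigenvalue_lt hΓ hbip hD1 h6 hi).ne'
        · exact h6
        · exact absurd hij (DRG.eigenvalue_lt hΓ hbip hD1 h6 (by omega)).ne
      rcases sq_eq_sq_iff_eq_or_eq_neg.1 h5 with h6 | h6
      · exact h3 (hinj n (by omega) h6)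
      · rw [← DRG.eigenvalue_sub hΓ hbip hD1 (by omega)] at h6
        exact h4 (hinj _ (by omega) h6)
  have hli := h.linearIndependent_primIdem hJle hne
  have hspan := h.span_primIdem hW hthin hJle hzero
  obtain ⟨N, hN0, hND, hNne, hNspan⟩ := h.exists_span_up hW hthin
  have hliN : LinearIndependent ℂ fun i : Fin N => DRG.up Γ x v i :=
    DRG.linearIndependent_of_supportedAt (m := fun i : Fin N => (i : ℕ) + 2)
      (fun i j hij => Fin.ext (by simpa using hij)) (fun i => DRG.supportedAt_up v i)
      fun i => hNne i i.2
  have hrange : Set.range (fun i : Fin N => DRG.up Γ x v i) = DRG.up Γ x v '' {i | i < N} := by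
    ext w
    constructor
    · rintro ⟨i, rfl⟩
      exact ⟨i, i.2, rfl⟩
    · rintro ⟨i, hi, rfl⟩
      exact ⟨⟨i, hi⟩, rfl⟩
  -- The two bases of `W` have equal size; this is what shows `up_i ≠ 0` for all `i ≤ D - 4`.
  have hcard : N = Γ.diam - 3 := by
    have e1 := finrank_span_eq_card hli
    have e2 := finrank_span_eq_card hliN
    rw [hspan, Fintype.card_coe, DRG.card_indexSet hn2.1 (by omega) (by omega)] at e1
    rw [hrange, hNspan, e1, Fintype.card_fin] at e2
    exact e2.symm
  have hup : ∀ i, i + 4 ≤ Γ.diam → DRG.up Γ x v i ≠ 0 := fun i hi => hNne i (by omega)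
  refine ⟨⟨hli, hspan⟩, ⟨?_, ?_⟩, fun i hi => ?_⟩
  · exact DRG.linearIndependent_of_supportedAt
      (m := fun i : {i : ℕ // i + 4 ≤ Γ.diam} => (i : ℕ) + 2)
      (fun i j hij => Subtype.ext (by simpa using hij)) (fun i => DRG.supportedAt_up v i)
      fun i => hup i i.2
  · rw [← hNspan]
    congr 1
    ext w
    constructor
    · rintro ⟨⟨i, hi⟩, rfl⟩
      exact ⟨i, show i < N by omega, rfl⟩
    · rintro ⟨i, hi, rfl⟩
      have hi' : i < N := hi
      exact ⟨⟨i, by omega⟩, rfl⟩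
  · rw [← h.aeval_mulVec_eq_sum hJle hzero]
    exact (h.aeval_g hthin hθ0.ne' hθ hη hup hi).symm
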